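/- Let $U\subseteq\mathbb C^2$ be a connected open set, let $d\ge 3$, and let $F=a_0\,p^d+a_1\,p^{d-1}+\cdots+a_d$ be a polynomial in $p$ with coefficients $a_i$ holomorphic on $U$, $a_0\not\equiv 0$, whose $p$-resultant $R_F=\mathrm{Result}(F,\partial_pF)=(-1)^{d(d-1)/2}a_0\,\Delta$ is not identically zero, where $\Delta$ is the $p$-discriminant of $F$. Let $|\Delta|=\{q\in U:\Delta(q)=0\}$ be the discriminant locus. On $U\setminus|\Delta|$ the differential equation $F(x,y,dy/dx)=0$, that is $\sum_{i=0}^d a_i(x,y)\,(dy)^{d-i}(dx)^{i}=0$, has $d$ distinct directions at every point (possibly vertical ones) and presents a nonsingular planar $d$-web $\mathcal W(d)$, locally given by $d$ foliations defined by nowhere vanishing holomorphic $1$-forms $\omega_1,\dots,\omega_d$. An infinitesimal symmetry of $\mathcal W(d)$ on an open set $V\subseteq U\setminus|\Delta|$ is a holomorphic vector field $X=\alpha\,\partial_x+\beta\,\partial_y$ on $V$ such that $\mathcal L_X(\omega)\wedge\omega=0$ for every nowhere vanishing holomorphic $1$-form $\omega$ on an open subset of $V$ that defines one of the foliations of the web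 there ($\mathcal L_X=i_X\circ d+d\circ i_X$ is the Lie derivative). Then the infinitesimal symmetries of $\mathcal W(d)$ form a sheaf $\mathcal S$ of $\mathbb C$-vector spaces on $U\setminus|\Delta|$ which is a local system of constant rank $r\in\{0,1,3\}$: every point of $U\setminus|\Delta|$ has an open neighbourhood on which $\mathcal S$ is isomorphic to the constant sheaf with fibre $\mathbb C^r$. In particular the value $\dim\mathcal S=2$ is impossible. -/

import Mathlib

open TopologicalSpace CategoryTheory Opposite Topology Filter

noncomputable section

namespace PlanarWeb

/-! ### Holomorphic functions on an open subset of `ℂ²` -/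

/-- The ring `𝒪(U)` of holomorphic functions on the open set `U ⊆ ℂ²`. -/
def Holo (U : Opens (ℂ × ℂ)) : Subalgebra ℂ (U → ℂ) where
  carrier := {f | ∃ g : ℂ × ℂ → ℂ, AnalyticOnNhd ℂ g (U : Set (ℂ × ℂ)) ∧ ∀ q : U, f q = g q}
  mul_mem' := by
    rintro f₁ f₂ ⟨g₁, h₁, e₁⟩ ⟨g₂, h₂, e₂⟩
    exact ⟨fun q => g₁ q * g₂ q, h₁.mul h₂, fun q => by simp [e₁, e₂]⟩
  add_mem' := by
    rintro f₁ f₂ ⟨g₁, h₁, e₁⟩ ⟨g₂, h₂, e₂⟩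
    exact ⟨fun q => g₁ q + g₂ q, h₁.add h₂, fun q => by simp [e₁, e₂]⟩
  algebraMap_mem' := by
    intro c
    exact ⟨fun _ => c, analyticOnNhd_const, fun q => rfl⟩

variable {U : Opens (ℂ × ℂ)}

theorem Holo.continuous (f : Holo U) : Continuous (f : U → ℂ) := by
  obtain ⟨f, g, hg, hf⟩ := f
  have h : f = fun q : U => g q := funext hf
  have : Continuous f := by
    rw [h]
    exact hg.continuousOn.comp_continuous continuous_subtype_val (fun q => q.2)
  exact this

/-! ### The implicit web presented by `F = a₀ p^d + ⋯ + a_d ∈ 𝒪(U)[p]`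

The degree `d` is `F.natDegree`, the `p`-resultant is `F.resultant F.derivative`, and the
`p`-discriminant is `F.discr`, an element of `𝒪(U)`. -/

/-- The discriminant locus `|Δ|`: the zero set in `U` of the `p`-discriminant of `F`. -/
def discriminantLocus (F : Polynomial (Holo U)) : Set (ℂ × ℂ) :=
  {q | ∃ h : q ∈ U, (F.discr : U → ℂ) ⟨q, h⟩ = 0}

theorem isOpen_diff_discriminantLocus (F : Polynomial (Holo U)) :
    IsOpen ((U : Set (ℂ × ℂ)) \ discriminantLocus F) := by
  have h : (U : Set (ℂ × ℂ)) \ discriminantLocus F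
      = Subtype.val '' {q : U | (F.discr : U → ℂ) q ≠ 0} := by
    ext q
    constructor
    · rintro ⟨h₁, h₂⟩
      exact ⟨⟨q, h₁⟩, fun h => h₂ ⟨h₁, h⟩, rfl⟩
    · rintro ⟨r, hr, rfl⟩
      exact ⟨r.2, fun ⟨_, h⟩ => hr h⟩
  rw [h]
  exact U.isOpen.isOpenMap_subtype_val _
    (isOpen_ne.preimage (Holo.continuous F.discr))

/-- The open set `U ∖ |Δ|`, on which the web is nonsingular. -/
def regularLocus (F : Polynomial (Holo U)) : Opens (ℂ × ℂ) :=
  ⟨(U : Set (ℂ × ℂ)) \ discriminantLocus F, isOpen_diff_discriminantLocus F⟩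

/-- The binary form `a₀ (dy)^d + a₁ (dy)^(d-1) dx + ⋯ + a_d (dx)^d` at the point `q`, evaluated
on the tangent vector `w = (dx, dy)`. A nonzero vector on which it vanishes is tangent to a leaf
of the web through `q`; on `w = (1, p)` its value is `F(q, p)`. -/
def binaryForm (F : Polynomial (Holo U)) (q : U) (w : ℂ × ℂ) : ℂ :=
  ∑ k ∈ Finset.range (F.natDegree + 1), (F.coeff k : U → ℂ) q * w.2 ^ k * w.1 ^ (F.natDegree - k)

/-- `ω` is, near `q`, a nowhere vanishing holomorphic `1`-form whose integral curves are leaves of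
the web presented by `F`, i.e. `ω` defines one of the foliations of the web near `q`. -/
def IsWebFormAt (F : Polynomial (Holo U)) (ω : ℂ × ℂ → (ℂ × ℂ →L[ℂ] ℂ)) (q : ℂ × ℂ) : Prop :=
  AnalyticAt ℂ ω q ∧
    ∀ᶠ q' in 𝓝 q, ω q' ≠ 0 ∧
      ∀ (h : q' ∈ U) (w : ℂ × ℂ), ω q' w = 0 → binaryForm F ⟨q', h⟩ w = 0

/-- The Lie derivative `ℒ_X ω = i_X (dω) + d (i_X ω)` at `q`, evaluated on the tangent
vector `v`; here `dω (u, v) = (D_u ω) v - (D_v ω) u`. -/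
def lieDeriv (X : ℂ × ℂ → ℂ × ℂ) (ω : ℂ × ℂ → (ℂ × ℂ →L[ℂ] ℂ)) (q v : ℂ × ℂ) : ℂ :=
  (fderiv ℂ ω q (X q) v - fderiv ℂ ω q v (X q)) + fderiv ℂ (fun q' => ω q' (X q')) q v

/-- The vector field `X` is holomorphic at `q` and `ℒ_X ω ∧ ω = 0` at `q` for every `1`-form `ω`
defining one of the foliations of the web near `q`. -/
def IsSymmetryAt (F : Polynomial (Holo U)) (X : ℂ × ℂ → ℂ × ℂ) (q : ℂ × ℂ) : Prop :=
  AnalyticAt ℂ X q ∧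
    ∀ ω : ℂ × ℂ → (ℂ × ℂ →L[ℂ] ℂ), IsWebFormAt F ω q →
      ∀ v w : ℂ × ℂ, lieDeriv X ω q v * ω q w - lieDeriv X ω q w * ω q v = 0

theorem lieDeriv_congr {X Y : ℂ × ℂ → ℂ × ℂ} {q : ℂ × ℂ} (h : X =ᶠ[𝓝 q] Y)
    (ω : ℂ × ℂ → (ℂ × ℂ →L[ℂ] ℂ)) (v : ℂ × ℂ) : lieDeriv X ω q v = lieDeriv Y ω q v := by
  have h' : (fun q' => ω q' (X q')) =ᶠ[𝓝 q] fun q' => ω q' (Y q') :=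
    h.mono fun q' hq => by simp [hq]
  simp only [lieDeriv, h.eq_of_nhds, h'.fderiv_eq]

theorem IsSymmetryAt.congr {F : Polynomial (Holo U)} {X Y : ℂ × ℂ → ℂ × ℂ} {q : ℂ × ℂ}
    (hX : IsSymmetryAt F X q) (h : X =ᶠ[𝓝 q] Y) : IsSymmetryAt F Y q := by
  refine ⟨hX.1.congr h, fun ω hω v w => ?_⟩
  rw [← lieDeriv_congr h, ← lieDeriv_congr h]
  exact hX.2 ω hω v w

theorem IsSymmetryAt.zero (F : Polynomial (Holo U)) (q : ℂ × ℂ) :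
    IsSymmetryAt F (fun _ => 0) q := by
  refine ⟨analyticAt_const, fun ω _ v w => ?_⟩
  simp [lieDeriv]

theorem IsSymmetryAt.add {F : Polynomial (Holo U)} {X Y : ℂ × ℂ → ℂ × ℂ} {q : ℂ × ℂ}
    (hX : IsSymmetryAt F X q) (hY : IsSymmetryAt F Y q) :
    IsSymmetryAt F (fun q => X q + Y q) q := by
  refine ⟨hX.1.add hY.1, fun ω hω v w => ?_⟩
  have key : ∀ v, lieDeriv (fun q => X q + Y q) ω q v = lieDeriv X ω q v + lieDeriv Y ω q v := by
    intro v
    have e : fderiv ℂ (fun q' => ω q' (X q' + Y q')) q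
        = fderiv ℂ (fun q' => ω q' (X q')) q + fderiv ℂ (fun q' => ω q' (Y q')) q := by
      simp only [map_add]
      exact fderiv_fun_add (hω.1.differentiableAt.clm_apply hX.1.differentiableAt)
        (hω.1.differentiableAt.clm_apply hY.1.differentiableAt)
    rw [lieDeriv, e]
    simp only [lieDeriv, map_add, add_apply]
    ring
  rw [key, key]
  linear_combination hX.2 ω hω v w + hY.2 ω hω v w

theorem IsSymmetryAt.smul {F : Polynomial (Holo U)} {X : ℂ × ℂ → ℂ × ℂ} {q : ℂ × ℂ} (c : ℂ)
    (hX : IsSymmetryAt F X q) : IsSymmetryAt F (fun q => c • X q) q := by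
  refine ⟨hX.1.fun_const_smul, fun ω hω v w => ?_⟩
  have key : ∀ v, lieDeriv (fun q => c • X q) ω q v = c * lieDeriv X ω q v := by
    intro v
    have e : fderiv ℂ (fun q' => ω q' (c • X q')) q = c • fderiv ℂ (fun q' => ω q' (X q')) q := by
      simp only [map_smul]
      exact fderiv_fun_const_smul (hω.1.differentiableAt.clm_apply hX.1.differentiableAt) c
    rw [lieDeriv, e]
    simp only [lieDeriv, map_smul, smul_apply, smul_eq_mul]
    ring
  rw [key, key]
  linear_combination c * hX.2 ω hω v w

/-! ### The sheaf of infinitesimal symmetries on `U ∖ |Δ|` -/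

/-- Extension by zero to `ℂ²` of a function on an open subset `V` of `Ω ⊆ ℂ²`. -/
def extend {Ω : Opens (ℂ × ℂ)} {V : Opens Ω} (s : V → ℂ × ℂ) : ℂ × ℂ → ℂ × ℂ :=
  Function.extend (fun q : V => ((q : Ω) : ℂ × ℂ)) s 0

theorem extend_apply {Ω : Opens (ℂ × ℂ)} {V : Opens Ω} (s : V → ℂ × ℂ) (q : V) :
    extend s ((q : Ω) : ℂ × ℂ) = s q :=
  (Subtype.val_injective.comp Subtype.val_injective).extend_apply s 0 q

theorem eventually_mem {Ω : Opens (ℂ × ℂ)} {V : Opens Ω} (q : V) :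
    ∀ᶠ q' in 𝓝 ((q : Ω) : ℂ × ℂ), ∃ r : V, ((r : Ω) : ℂ × ℂ) = q' := by
  have ho : IsOpen (Set.range fun r : V => ((r : Ω) : ℂ × ℂ)) :=
    (Ω.isOpen.isOpenMap_subtype_val.comp V.isOpen.isOpenMap_subtype_val).isOpen_range
  exact ho.mem_nhds ⟨q, rfl⟩

theorem extend_eventuallyEq {Ω : Opens (ℂ × ℂ)} {V : Opens Ω} (s : V → ℂ × ℂ)
    (X : ℂ × ℂ → ℂ × ℂ) (h : ∀ r : V, X ((r : Ω) : ℂ × ℂ) = s r) (q : V) :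
    X =ᶠ[𝓝 ((q : Ω) : ℂ × ℂ)] extend s := by
  filter_upwards [eventually_mem q]
  rintro _ ⟨r, rfl⟩
  rw [extend_apply, h]

/-- The `ℂ`-vector space `𝒮(V)` of symmetries of the web over an open set `V ⊆ U ∖ |Δ|`. -/
def symmetries (F : Polynomial (Holo U)) (V : Opens (regularLocus F)) :
    Submodule ℂ (V → ℂ × ℂ) where
  carrier := {s | ∀ q : V, IsSymmetryAt F (extend s) ((q : regularLocus F) : ℂ × ℂ)}
  zero_mem' := fun q =>
    (IsSymmetryAt.zero F _).congr (extend_eventuallyEq _ _ (fun _ => rfl) q)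
  add_mem' := fun {s t} hs ht q =>
    ((hs q).add (ht q)).congr
      (extend_eventuallyEq _ _ (fun r => by simp [extend_apply]) q)
  smul_mem' := fun c s hs q =>
    ((hs q).smul c).congr
      (extend_eventuallyEq _ _ (fun r => by simp [extend_apply]) q)

/-- Restriction of symmetries from `V` to a smaller open set `W`. -/
def symmetriesRes (F : Polynomial (Holo U)) {V W : Opens (regularLocus F)} (h : W ≤ V) :
    symmetries F V →ₗ[ℂ] symmetries F W where
  toFun s := ⟨fun q => s.1 ⟨q, h q.2⟩, fun q =>
    (s.2 ⟨q, h q.2⟩).congr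
      (extend_eventuallyEq _ _ (fun r => extend_apply s.1 ⟨r, h r.2⟩) q)⟩
  map_add' _ _ := rfl
  map_smul' _ _ := rfl

/-- The presheaf of symmetries on `U ∖ |Δ|`. -/
def symmetryPresheaf (F : Polynomial (Holo U)) :
    TopCat.Presheaf (ModuleCat.{0} ℂ) (TopCat.of (regularLocus F)) where
  obj V := ModuleCat.of ℂ (symmetries F V.unop)
  map f := ModuleCat.ofHom (symmetriesRes F f.unop.le)

theorem symmetryPresheaf_isSheaf (F : Polynomial (Holo U)) : (symmetryPresheaf F).IsSheaf := by
  rw [TopCat.Presheaf.isSheaf_iff_isSheafUniqueGluing]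
  intro ι V sf hsf
  have hc : ∀ (i j : ι) (q : regularLocus F) (hi : q ∈ V i) (hj : q ∈ V j),
      (sf i : symmetries F (V i)).1 ⟨q, hi⟩ = (sf j : symmetries F (V j)).1 ⟨q, hj⟩ := by
    intro i j q hi hj
    have h := congrArg (fun s : symmetries F (V i ⊓ V j) => s.1 ⟨q, hi, hj⟩) (hsf i j)
    exact h
  have hm : ∀ q : ↥(iSup V), ∃ i, (q : regularLocus F) ∈ V i :=
    fun q => Opens.mem_iSup.1 q.2
  choose k hk using hm
  let g : ↥(iSup V) → ℂ × ℂ :=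
    fun q => (sf (k q) : symmetries F (V (k q))).1 ⟨q, hk q⟩
  have hg : ∀ (i : ι) (q : V i), g ⟨q, Opens.mem_iSup.2 ⟨i, q.2⟩⟩ =
      (sf i : symmetries F (V i)).1 q := fun i q => hc _ _ _ _ _
  have hgs : g ∈ symmetries F (iSup V) := by
    intro q
    have hs := (sf (k q) : symmetries F (V (k q))).2 ⟨q, hk q⟩
    refine hs.congr ?_
    have h1 := extend_eventuallyEq (sf (k q) : symmetries F (V (k q))).1 (extend g)
      (fun r => by
        rw [← hg]
        exact extend_apply g ⟨r, _⟩) ⟨q, hk q⟩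
    exact h1.symm
  refine ⟨(⟨g, hgs⟩ : symmetries F (iSup V)), fun i => Subtype.ext (funext (hg i)), ?_⟩
  intro t ht
  refine Subtype.ext (funext fun q => ?_)
  have h := congrArg (fun s : symmetries F (V (k q)) => s.1 ⟨q, hk q⟩) (ht (k q))
  exact h

/-- The sheaf `𝒮` of infinitesimal symmetries of the web, on `U ∖ |Δ|`. -/
def symmetrySheaf (F : Polynomial (Holo U)) :
    TopCat.Sheaf (ModuleCat.{0} ℂ) (TopCat.of (regularLocus F)) :=
  ⟨symmetryPresheaf F, symmetryPresheaf_isSheaf F⟩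

/-! ### Local systems -/

/-- The constant sheaf on `T` with fibre the `ℂ`-vector space `M`: its sections over `V` are the
locally constant functions from `V` to `M`. -/
def constantSheafOn (T : TopCat.{0}) (M : Type) [AddCommGroup M] [Module ℂ M] :
    TopCat.Presheaf (ModuleCat.{0} ℂ) T where
  obj V := ModuleCat.of ℂ (LocallyConstant V.unop M)
  map f := ModuleCat.ofHom
    (LocallyConstant.comapₗ ℂ ⟨Set.inclusion f.unop.le, continuous_inclusion f.unop.le⟩)

/-- A sheaf of `ℂ`-vector spaces is a local system of rank `r` if every point has an open
neighbourhood on which the sheaf is isomorphic to the constant sheaf with fibre `ℂ^r`. -/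
def IsLocalSystem {T : TopCat.{0}} (𝒮 : TopCat.Sheaf (ModuleCat.{0} ℂ) T) (r : ℕ) : Prop :=
  ∀ q : T, ∃ V : Opens T, q ∈ V ∧
    Nonempty (V.isOpenEmbedding.functor.op ⋙ 𝒮.presheaf ≅
      constantSheafOn (TopCat.of V) (Fin r → ℂ))

end PlanarWeb

end

/-! Near a regular point the zeros of the binary form of `F` are d distinct holomorphic directions
wᵢ (`exists_web_frame`), and a holomorphic X is a symmetry iff every [X, wᵢ] is parallel to wᵢ
(`isSymmetryAt_iff`). Equivalently, the quadratic form x ↦ det(x, DX x) takes at wᵢ the value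
det(wᵢ, Dwᵢ X), in which X is not differentiated. As d ≥ 3, three such values determine the form
(`lagrange_interpolation`), hence DX up to a multiple of the identity, in terms of X. One further
differentiation controls the missing unknown γ = ∂ₓX₁, so (X, γ) is a flat section of a linear
connection on ℂ³ (`fderiv_jet`). A flat germ is determined by its value at a point and extends to a
ball depending only on the connection (`eventuallyEq_zero_of_flat`, `exists_ball_flat_extension`).
Hence symmetries have local bases of at most three elements (`exists_isLocalBasis`).

A basis Y₀, Y₁ of two elements is impossible (`not_rank_two`). If Y₀ and Y₁ are independent at a
point, then [Y₀, Y₁] = c₀Y₀ + c₁Y₁ with constant cᵢ. An integrating factor e and functions u, v with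
Y₀u = Y₁v = e and Y₁u = Y₀v = 0 then make uY₀ + vY₁ a symmetry outside their span
(`not_transitive_rank_two`). If they are everywhere proportional, then Y₁ = fY₀ near a point where
Y₀ ≠ 0; two of three web directions are transverse to Y₀ and force df = 0
(`exists_const_of_proportional`).

Finally, the zeros of the discriminant do not disconnect U (`isPreconnected_regularLocus`), so the
locally constant rank is constant (`exists_rank`), and coefficients in a local basis identify
sections with locally constant functions (`sectionMap_bijective`). -/

namespace PlanarWeb

/-! ### Linear Pfaffian systems Ds = M s with analytic coefficients. -/

noncomputable section FlatSystem

open scoped NNReal ENNReal Nat ContDiff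


section FlatSystems

variable {E G H : Type*} [NormedAddCommGroup E] [NormedSpace ℂ E]
  [NormedAddCommGroup G] [NormedSpace ℂ G] [CompleteSpace G]
  [NormedAddCommGroup H] [NormedSpace ℂ H] [CompleteSpace H]

/-- The n-th derivative is the sum of `p n` over the n! permutations of its arguments, and each
summand has norm at most ‖p n‖. -/
theorem norm_iteratedFDeriv_le_of_hasFPowerSeriesOnBall {f : E → H}
    {p : FormalMultilinearSeries ℂ E H} {q : E} {r : ℝ≥0∞} (h : HasFPowerSeriesOnBall f p q r)
    (n : ℕ) : ‖iteratedFDeriv ℂ n f q‖ ≤ (n ! : ℝ) * ‖p n‖ := by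
  refine ContinuousMultilinearMap.opNorm_le_bound (by positivity) fun v => ?_
  rw [h.iteratedFDeriv_eq_sum_of_completeSpace v]
  refine (norm_sum_le _ _).trans ?_
  have : ∀ σ ∈ (Finset.univ : Finset (Equiv.Perm (Fin n))),
      ‖p n (fun i => v (σ i))‖ ≤ ‖p n‖ * ∏ i, ‖v i‖ := fun σ _ => by
    refine ((p n).le_opNorm _).trans_eq ?_
    rw [Equiv.prod_comp σ (fun i => ‖v i‖)]
  refine (Finset.sum_le_card_nsmul _ _ _ this).trans_eq ?_
  rw [Finset.card_univ, Fintype.card_perm, Fintype.card_fin, nsmul_eq_mul, mul_assoc]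

theorem analyticAt_clm_apply {H' : Type*} [NormedAddCommGroup H'] [NormedSpace ℂ H']
    [CompleteSpace H'] {f : E → H →L[ℂ] H'} {g : E → H} {q : E}
    (hf : AnalyticAt ℂ f q) (hg : AnalyticAt ℂ g q) : AnalyticAt ℂ (fun z => f z (g z)) q :=
  (ContDiffAt.clm_apply (n := ω) hf.contDiffAt hg.contDiffAt).analyticAt

/-- Cauchy estimates for the derivatives of an analytic map, uniform near a point. -/
theorem exists_norm_iteratedFDeriv_le {M : E → H} {q₀ : E} (hM : AnalyticAt ℂ M q₀) :
    ∃ C > 0, ∃ K > 0, ∃ ρ > 0, ∀ q ∈ Metric.ball q₀ ρ, ∀ n : ℕ,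
      ‖iteratedFDeriv ℂ n M q‖ ≤ C * K ^ n * n ! := by
  obtain ⟨p, R, hp⟩ := hM
  obtain ⟨r, hr0, hr⟩ := ENNReal.lt_iff_exists_nnreal_btwn.1 hp.r_pos
  have hr0' : (0 : ℝ≥0) < r := by exact_mod_cast hr0
  -- Half the radius: recentring the series at any y with ‖y‖ < t still leaves radius t, with one
  -- bound T for all such y.
  set t : ℝ≥0 := r / 2 with ht
  have ht0 : 0 < t := by positivity
  have htt : ((t : ℝ≥0∞) + t) < p.radius := by
    have : t + t = r := by rw [ht]; exact add_halves r
    rw [← ENNReal.coe_add, this]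
    exact hr.trans_le hp.r_le
  have hs := p.changeOriginSeries_summable_aux₁ htt
  set T := ∑' s : Σ k l : ℕ, { s : Finset (Fin (k + l)) // s.card = l },
    ‖p (s.1 + s.2.1)‖₊ * t ^ s.2.1 * t ^ s.1
  refine ⟨T + 1, by positivity, (t : ℝ)⁻¹, by positivity, t, by exact_mod_cast ht0, ?_⟩
  intro q hq n
  set y := q - q₀ with hy
  have hyt : ‖y‖₊ < t := by
    rw [Metric.mem_ball, dist_eq_norm] at hq
    exact_mod_cast hq
  have hyR : (‖y‖₊ : ℝ≥0∞) < R := by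
    refine lt_trans ?_ hr
    have : t ≤ r := by rw [ht]; exact half_le_self zero_le
    exact_mod_cast hyt.trans_le this
  have hc := hp.changeOrigin hyR
  rw [hy, add_sub_cancel] at hc
  have h1 := norm_iteratedFDeriv_le_of_hasFPowerSeriesOnBall hc n
  have h2 := p.nnnorm_changeOrigin_le n (hyR.trans_le hp.r_le)
  have h3 : ‖p.changeOrigin y n‖₊ * t ^ n ≤ T := by
    have hfib := (NNReal.summable_sigma.1 hs).1 n
    have h4 : ‖p.changeOrigin y n‖₊ ≤
      ∑' s : Σ l : ℕ, { s : Finset (Fin (n + l)) // s.card = l }, ‖p (n + s.1)‖₊ * t ^ s.1 := by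
      refine h2.trans ?_
      have hst : (t : ℝ≥0∞) < p.radius := lt_of_le_of_lt le_self_add htt
      refine Summable.tsum_le_tsum (fun s => ?_)
        (p.changeOriginSeries_summable_aux₂ (hyR.trans_le hp.r_le) n)
        (p.changeOriginSeries_summable_aux₂ hst n)
      gcongr
    calc ‖p.changeOrigin y n‖₊ * t ^ n ≤ (∑' s : Σ l : ℕ, { s : Finset (Fin (n + l)) // s.card = l },
          ‖p (n + s.1)‖₊ * t ^ s.1) * t ^ n := by gcongr
      _ = ∑' s : Σ l : ℕ, { s : Finset (Fin (n + l)) // s.card = l },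
          ‖p (n + s.1)‖₊ * t ^ s.1 * t ^ n := by rw [NNReal.tsum_mul_right]
      _ ≤ T := (NNReal.summable_sigma.1 hs).2.le_tsum n (fun _ _ => zero_le) |>.trans_eq
          ((NNReal.hasSum_coe.1 (by exact_mod_cast hs.hasSum.sigma fun k => ((NNReal.summable_sigma.1 hs).1 k).hasSum : HasSum _ _)).tsum_eq)
  have h3' : ‖p.changeOrigin y n‖ * (t : ℝ) ^ n ≤ T := by exact_mod_cast h3
  have h5 : ‖p.changeOrigin y n‖ ≤ (T + 1) * ((t : ℝ)⁻¹) ^ n := by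
    rw [inv_pow, ← div_eq_mul_inv, le_div_iff₀ (by positivity)]
    linarith
  calc ‖iteratedFDeriv ℂ n M q‖ ≤ (n ! : ℝ) * ‖p.changeOrigin (q - q₀) n‖ := h1
    _ ≤ (n ! : ℝ) * ((T + 1) * ((t : ℝ)⁻¹) ^ n) := by gcongr
    _ = _ := by ring

/-- Writing C = (K + C) - K telescopes the sum to a((K + C)^(n+1) - K^(n+1)). This is why K + C is
the growth rate that closes the induction below. -/
theorem sum_geom_le {C K a : ℝ} (hK : 0 < K) (ha : 0 ≤ a) (n : ℕ) :
    ∑ i ∈ Finset.range (n + 1), C * K ^ i * (a * (K + C) ^ (n - i)) ≤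
      a * (K + C) ^ (n + 1) := by
  have h := Commute.geom_sum₂_mul (Commute.all K (K + C)) (n + 1)
  have h' : ∑ i ∈ Finset.range (n + 1), C * K ^ i * (a * (K + C) ^ (n - i)) =
      a * (C * ∑ i ∈ Finset.range (n + 1), K ^ i * (K + C) ^ (n + 1 - 1 - i)) := by
    rw [Finset.mul_sum, Finset.mul_sum]
    refine Finset.sum_congr rfl fun i _ => ?_
    rw [Nat.add_sub_cancel]; ring
  rw [h']
  have : C * ∑ i ∈ Finset.range (n + 1), K ^ i * (K + C) ^ (n + 1 - 1 - i)
      = (K + C) ^ (n + 1) - K ^ (n + 1) := by linear_combination -h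
  rw [this]
  have : 0 ≤ K ^ (n + 1) := by positivity
  exact mul_le_mul_of_nonneg_left (by linarith) ha

/-- Derivative bounds for a solution of the linear Pfaffian system `Ds = M s`. -/
theorem norm_iteratedFDeriv_le_of_flat {M : E → G →L[ℂ] (E →L[ℂ] G)} {s : E → G} {q : E}
    {C K : ℝ} (hC : 0 < C) (hK : 0 < K)
    (hb : ∀ n : ℕ, ‖iteratedFDeriv ℂ n M q‖ ≤ C * K ^ n * n !)
    (hM : AnalyticAt ℂ M q) (hs : AnalyticAt ℂ s q)
    (hflat : ∀ᶠ q' in 𝓝 q, fderiv ℂ s q' = M q' (s q')) (n : ℕ) :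
    ‖iteratedFDeriv ℂ n s q‖ ≤ ‖s q‖ * (K + C) ^ n * n ! := by
  induction n using Nat.strong_induction_on with
  | _ n ih =>
  rcases n with _ | n
  · simp
  obtain ⟨u, huo, hqu, hMu, hsu⟩ : ∃ u, IsOpen u ∧ q ∈ u ∧ ContDiffOn ℂ ω M u ∧ ContDiffOn ℂ ω s u := by
    obtain ⟨u, hu, huo, hqu⟩ := eventually_nhds_iff.1
      (hM.eventually_analyticAt.and hs.eventually_analyticAt)
    exact ⟨u, huo, hqu, fun x hx => (hu x hx).1.contDiffAt.contDiffWithinAt,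
      fun x hx => (hu x hx).2.contDiffAt.contDiffWithinAt⟩
  -- By the equation, the derivative of s of order n + 1 is the n-th derivative of M s, which the
  -- Leibniz rule bounds by lower derivatives of s.
  have e1 : ‖iteratedFDeriv ℂ (n + 1) s q‖ = ‖iteratedFDeriv ℂ n (fun q' => M q' (s q')) q‖ := by
    rw [← norm_iteratedFDeriv_fderiv]
    congr 1
    exact (Filter.EventuallyEq.iteratedFDeriv ℂ hflat n).eq_of_nhds
  have e2 := norm_iteratedFDerivWithin_clm_apply (n := n) hMu hsu huo.uniqueDiffOn hqu le_top
  simp only [iteratedFDerivWithin_of_isOpen _ huo hqu] at e2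
  rw [e1]
  refine e2.trans ?_
  have e3 : ∀ i ∈ Finset.range (n + 1), (n.choose i : ℝ) * ‖iteratedFDeriv ℂ i M q‖ *
      ‖iteratedFDeriv ℂ (n - i) s q‖ ≤ (n ! : ℝ) * (C * K ^ i * (‖s q‖ * (K + C) ^ (n - i))) := by
    intro i hi
    have hi' : i ≤ n := Nat.lt_succ_iff.1 (Finset.mem_range.1 hi)
    calc (n.choose i : ℝ) * ‖iteratedFDeriv ℂ i M q‖ * ‖iteratedFDeriv ℂ (n - i) s q‖
        ≤ (n.choose i : ℝ) * (C * K ^ i * i !) * (‖s q‖ * (K + C) ^ (n - i) * (n - i)!) := by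
          gcongr
          · exact hb i
          · exact ih (n - i) (by omega)
      _ = ((n.choose i * i ! * (n - i)! : ℕ) : ℝ) * (C * K ^ i * (‖s q‖ * (K + C) ^ (n - i))) := by
          push_cast; ring
      _ = _ := by rw [Nat.choose_mul_factorial_mul_factorial hi']
  refine (Finset.sum_le_sum e3).trans ?_
  rw [← Finset.mul_sum]
  have e4 := sum_geom_le (C := C) hK (norm_nonneg (s q)) n
  have e5 : ((n + 1)! : ℝ) = (n + 1) * n ! := by push_cast [Nat.factorial_succ]; ring
  have e6 : 0 ≤ ‖s q‖ * (K + C) ^ (n + 1) := by positivity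
  -- The induction already gives n!; the factor n + 1 is given away.
  calc _ ≤ (n ! : ℝ) * (‖s q‖ * (K + C) ^ (n + 1)) := by gcongr
    _ ≤ (n + 1) * ((n ! : ℝ) * (‖s q‖ * (K + C) ^ (n + 1))) :=
        le_mul_of_one_le_left (by positivity) (by linarith [(Nat.cast_nonneg n : (0:ℝ) ≤ n)])
    _ = _ := by rw [e5]; ring

/-- The derivative bounds are proportional to ‖s q‖, so the whole Taylor series at q vanishes with s
q. -/
theorem eventuallyEq_zero_of_flat {M : E → G →L[ℂ] (E →L[ℂ] G)} {s : E → G} {q : E}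
    (hM : AnalyticAt ℂ M q) (hs : AnalyticAt ℂ s q)
    (hflat : ∀ᶠ q' in 𝓝 q, fderiv ℂ s q' = M q' (s q')) (h0 : s q = 0) : s =ᶠ[𝓝 q] 0 := by
  obtain ⟨C, hC, K, hK, ρ, hρ, hb⟩ := exists_norm_iteratedFDeriv_le hM
  have hb' := norm_iteratedFDeriv_le_of_flat hC hK (hb q (Metric.mem_ball_self hρ)) hM hs hflat
  obtain ⟨p, r, hp⟩ := hs
  have : ∀ᶠ q' in 𝓝 q, q' ∈ Metric.eball q r := Metric.eball_mem_nhds q hp.r_pos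
  filter_upwards [this] with q' hq'
  have hy : q' - q ∈ Metric.eball (0 : E) r := by
    simpa [edist_eq_enorm_sub] using hq'
  have h1 := hp.hasSum_iteratedFDeriv hy
  rw [add_sub_cancel] at h1
  refine h1.unique ?_
  convert! hasSum_zero using 2 with n
  have : iteratedFDeriv ℂ n s q = 0 := by
    rw [← norm_le_zero_iff]
    simpa [h0] using hb' n
  simp [this]

/-- Solutions of a linear Pfaffian system with analytic coefficients extend to a neighbourhood
which depends only on the system. -/
theorem exists_ball_flat_extension {M : E → G →L[ℂ] (E →L[ℂ] G)} {q₀ : E}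
    (hM : AnalyticAt ℂ M q₀) :
    ∃ ρ > 0, ∀ q ∈ Metric.ball q₀ ρ, ∀ s : E → G, AnalyticAt ℂ s q →
      (∀ᶠ q' in 𝓝 q, fderiv ℂ s q' = M q' (s q')) →
      ∃ S : E → G, AnalyticOnNhd ℂ S (Metric.ball q₀ ρ) ∧ S =ᶠ[𝓝 q] s ∧
        ∀ q' ∈ Metric.ball q₀ ρ, fderiv ℂ S q' = M q' (S q') := by
  obtain ⟨C, hC, K, hK, ρ₁, hρ₁, hb⟩ := exists_norm_iteratedFDeriv_le hM
  obtain ⟨ρ₂, hρ₂, han⟩ := Metric.eventually_nhds_iff_ball.1 hM.eventually_analyticAt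
  -- The Taylor series of any solution at any q near q₀ has radius at least R. With ρ ≤ R / 2 the
  -- ball of radius ρ about q₀ lies in the ball of radius R about each of its points.
  set R : ℝ≥0 := ⟨(K + C)⁻¹, by positivity⟩ with hR
  have hR' : (R : ℝ) = (K + C)⁻¹ := rfl
  have hR0 : (0 : ℝ) < R := by rw [hR']; positivity
  refine ⟨min (min ρ₁ ρ₂) (R / 2), by positivity, ?_⟩
  set ρ := min (min ρ₁ ρ₂) ((R : ℝ) / 2) with hρ
  have l1 : ρ ≤ ρ₁ := (min_le_left _ _).trans (min_le_left _ _)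
  have l2 : ρ ≤ ρ₂ := (min_le_left _ _).trans (min_le_right _ _)
  have l3 : ρ ≤ R / 2 := min_le_right _ _
  intro q hq s hs hflat
  have hMq : AnalyticOnNhd ℂ M (Metric.ball q₀ ρ) := fun x hx => han x (Metric.ball_subset_ball l2 hx)
  have hbd := norm_iteratedFDeriv_le_of_flat hC hK (hb q (Metric.ball_subset_ball l1 hq))
    (hMq q hq) hs hflat
  let p : FormalMultilinearSeries ℂ E G := fun n => (n ! : ℂ)⁻¹ • iteratedFDeriv ℂ n s q
  have hrad : (R : ℝ≥0∞) ≤ p.radius := by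
    refine p.le_radius_of_bound ‖s q‖ fun n => ?_
    have : ‖p n‖ ≤ ‖s q‖ * (K + C) ^ n := by
      simp only [p, norm_smul, norm_inv, Complex.norm_natCast]
      rw [inv_mul_le_iff₀ (by positivity)]
      linarith [hbd n]
    calc ‖p n‖ * (R : ℝ) ^ n ≤ ‖s q‖ * (K + C) ^ n * (R : ℝ) ^ n := by gcongr
      _ = ‖s q‖ := by rw [hR', mul_assoc, ← mul_pow, mul_inv_cancel₀ (by positivity)]; simp
  have hpos : 0 < p.radius := lt_of_lt_of_le (by exact_mod_cast hR0) hrad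
  have hsum := (p.hasFPowerSeriesOnBall hpos).comp_sub q
  rw [zero_add] at hsum
  set S : E → G := fun z => p.sum (z - q) with hS
  have hsub : Metric.ball q₀ ρ ⊆ Metric.eball q p.radius := by
    intro z hz
    refine Metric.eball_subset_eball hrad ?_
    rw [Metric.eball_coe, Metric.mem_ball]
    have := dist_triangle z q₀ q
    rw [Metric.mem_ball] at hz hq
    rw [dist_comm q₀ q] at this
    linarith
  have hSan : AnalyticOnNhd ℂ S (Metric.ball q₀ ρ) := fun z hz => hsum.analyticOnNhd z (hsub hz)
  have hSs : S =ᶠ[𝓝 q] s := by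
    obtain ⟨p', r, hp'⟩ := hs
    filter_upwards [Metric.eball_mem_nhds q hp'.r_pos,
      Metric.eball_mem_nhds q hpos] with q' hq' hq''
    have hy : q' - q ∈ Metric.eball (0 : E) r := by
      simpa [edist_eq_enorm_sub] using hq'
    have hy' : q' - q ∈ Metric.eball (0 : E) p.radius := by
      simpa [edist_eq_enorm_sub] using hq''
    have h1 := hp'.hasSum_iteratedFDeriv hy
    rw [add_sub_cancel] at h1
    exact (p.hasSum hy').unique h1
  refine ⟨S, hSan, hSs, ?_⟩
  -- Both sides of the equation are analytic on the ball and agree near q, so the identity theorem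
  -- propagates it; no integrability of M is needed.
  have hlhs : AnalyticOnNhd ℂ (fderiv ℂ S) (Metric.ball q₀ ρ) := hSan.fderiv
  have hrhs : AnalyticOnNhd ℂ (fun z => M z (S z)) (Metric.ball q₀ ρ) := fun z hz =>
    analyticAt_clm_apply (f := M) (g := S) (hMq z hz) (hSan z hz)
  refine hlhs.eqOn_of_preconnected_of_eventuallyEq hrhs
    (convex_ball q₀ ρ).isPreconnected hq ?_
  filter_upwards [hSs.fderiv (𝕜 := ℂ), hSs, hflat] with z h1 h2 h3
  rw [h1, h3, h2]

end FlatSystems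

end FlatSystem

/-! ### Holomorphic primitives of closed 1-forms. -/

noncomputable section Primitive

open scoped NNReal ENNReal Nat


/-- The formal antiderivative of a power series of `1`-forms, with constant term `c`. -/
def antiderivSeries {E : Type*} [NormedAddCommGroup E] [NormedSpace ℂ E]
    (p : FormalMultilinearSeries ℂ E (E →L[ℂ] ℂ)) (c : ℂ) : FormalMultilinearSeries ℂ E ℂ
  | 0 => ContinuousMultilinearMap.uncurry0 ℂ E c
  | n + 1 => ((n + 1 : ℕ) : ℂ)⁻¹ • (p n).uncurryRight

theorem iteratedDeriv_of_hasSum {ψ : ℂ → ℂ} {c : ℕ → ℂ}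
    (h : ∀ᶠ z in 𝓝 (0 : ℂ), HasSum (fun n => z ^ n * c n) (ψ z)) (n : ℕ) :
    iteratedDeriv n ψ 0 = n ! * c n := by
  let p : FormalMultilinearSeries ℂ ℂ ℂ := fun n => ContinuousMultilinearMap.mkPiRing ℂ (Fin n) (c n)
  have hp : HasFPowerSeriesAt ψ p 0 := by
    rw [hasFPowerSeriesAt_iff]
    filter_upwards [h] with z hz
    simpa [p, FormalMultilinearSeries.coeff] using hz
  obtain ⟨r, hr⟩ := hp
  have := hr.factorial_smul (1 : ℂ) n
  rw [iteratedDeriv_eq_iteratedFDeriv, ← this]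
  simp [p]

/-- Integrating the series of η degree by degree gives a convergent candidate. That its sum is u is
checked on complex lines through q, where the one-variable Taylor theorem applies. -/
theorem analyticAt_of_hasFDerivAt {E : Type*} [NormedAddCommGroup E] [NormedSpace ℂ E]
    {η : E → (E →L[ℂ] ℂ)} {q : E}
    (hη : AnalyticAt ℂ η q) {u : E → ℂ} (hu : ∀ᶠ z in 𝓝 q, HasFDerivAt u (η z) z) :
    AnalyticAt ℂ u q := by
  obtain ⟨p, R, hp⟩ := hη
  obtain ⟨ρ, hρ, hball⟩ := Metric.eventually_nhds_iff_ball.1 hu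
  obtain ⟨r, hr0, hr⟩ := ENNReal.lt_iff_exists_nnreal_btwn.1 hp.r_pos
  have hr0' : (0 : ℝ) < r := by exact_mod_cast hr0
  obtain ⟨C, hC, hCb⟩ := p.norm_mul_pow_le_of_lt_radius (hr.trans_le hp.r_le)
  set P := antiderivSeries p (u q) with hP
  have hrad : (r : ℝ≥0∞) ≤ P.radius := by
    refine P.le_radius_of_bound (‖P 0‖ + C * r) fun n => ?_
    rcases n with _ | n
    · simp only [pow_zero, mul_one]
      exact le_add_of_nonneg_right (by positivity)
    · have h1 : ‖P (n + 1)‖ ≤ ‖p n‖ := by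
        rw [hP, antiderivSeries, norm_smul, norm_inv, Complex.norm_natCast,
          ContinuousMultilinearMap.uncurryRight_norm]
        exact mul_le_of_le_one_left (norm_nonneg (p n))
          (inv_le_one_of_one_le₀ (by push_cast; linarith [(Nat.cast_nonneg n : (0:ℝ) ≤ n)]))
      calc ‖P (n + 1)‖ * (r : ℝ) ^ (n + 1) ≤ ‖p n‖ * (r : ℝ) ^ (n + 1) := by gcongr
        _ = ‖p n‖ * (r : ℝ) ^ n * r := by ring
        _ ≤ C * r := by gcongr; exact hCb n
        _ ≤ _ := le_add_of_nonneg_left (norm_nonneg _)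
  -- Halved so that z ↦ u(q + z y) is holomorphic on the disc of radius 2, which has z = 1 in its
  -- interior.
  set t : ℝ := min ρ r / 2 with ht
  have ht0 : 0 < t := by positivity
  refine ⟨P, ENNReal.ofReal t, ?_, by simpa using ht0, ?_⟩
  · refine le_trans ?_ hrad
    rw [ENNReal.ofReal_le_iff_le_toReal (by simp)]
    simp only [ENNReal.coe_toReal, ht]
    have : min ρ (r : ℝ) ≤ r := min_le_right _ _
    linarith
  · intro y hy
    rw [Metric.eball_ofReal, mem_ball_zero_iff] at hy
    have hmem : ∀ z ∈ Metric.ball (0 : ℂ) 2, ‖z • y‖ < min ρ r := by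
      intro z hz
      rw [mem_ball_zero_iff] at hz
      rw [norm_smul]
      have : ‖z‖ * ‖y‖ ≤ 2 * ‖y‖ := by gcongr
      rw [ht] at hy
      linarith
    set g : ℂ → ℂ := fun z => u (q + z • y) with hg
    have hder : ∀ z ∈ Metric.ball (0 : ℂ) 2, HasDerivAt g (η (q + z • y) y) z := by
      intro z hz
      have h1 : HasFDerivAt u (η (q + z • y)) (q + z • y) := hball _ (by
        rw [Metric.mem_ball, dist_eq_norm, add_sub_cancel_left]
        exact (hmem z hz).trans_le (min_le_left _ _))
      have h2 : HasDerivAt (fun z : ℂ => q + z • y) y z := by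
        simpa using ((hasDerivAt_id z).smul_const y).const_add q
      exact h1.comp_hasDerivAt z h2
    have hsum := Complex.hasSum_taylorSeries_on_ball (f := g) (c := 0) (r := 2)
      (fun z hz => (hder z hz).differentiableAt.differentiableWithinAt)
      (z := 1) (by simp)
    have hg1 : g 1 = u (q + y) := by simp [hg]
    rw [hg1] at hsum
    convert! hsum using 2 with n
    rcases n with _ | n
    · simp [hP, antiderivSeries, hg]
    · have h3 : iteratedDeriv (n + 1) g 0 = n ! * (p n (fun _ => y) y) := by
        rw [iteratedDeriv_succ']
        have : deriv g =ᶠ[𝓝 0] fun z => η (q + z • y) y := by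
          filter_upwards [Metric.ball_mem_nhds (0 : ℂ) (show (0:ℝ) < 2 by norm_num)] with z hz
          exact (hder z hz).deriv
        rw [(this.iteratedDeriv_eq n)]
        refine iteratedDeriv_of_hasSum (c := fun n => p n (fun _ => y) y) ?_ n
        filter_upwards [Metric.ball_mem_nhds (0 : ℂ) (show (0:ℝ) < 2 by norm_num)] with z hz
        have h4 := hp.hasSum (y := z • y) (by
          refine Metric.eball_subset_eball hr.le ?_
          rw [Metric.eball_coe, mem_ball_zero_iff]
          exact (hmem z hz).trans_le (min_le_right _ _))
        have h5 := h4.mapL (ContinuousLinearMap.apply ℂ ℂ y)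
        convert! h5 using 2 with k
        have := (p k).map_smul_univ (fun _ => z) (fun _ => y)
        simp [this]
      rw [h3, hP, antiderivSeries]
      simp only [sub_zero, one_pow, smul_eq_mul, one_mul, smul_apply]
      rw [Nat.factorial_succ, ContinuousMultilinearMap.uncurryRight_apply]
      push_cast
      have : (n ! : ℂ) ≠ 0 := by exact_mod_cast n.factorial_ne_zero
      have : (n + 1 : ℂ) ≠ 0 := by exact_mod_cast n.succ_ne_zero
      field_simp
      rfl

/-- Closed holomorphic `1`-forms have local holomorphic primitives. -/
theorem exists_analyticAt_primitive {η : ℂ × ℂ → (ℂ × ℂ →L[ℂ] ℂ)} {q : ℂ × ℂ}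
    (hη : AnalyticAt ℂ η q)
    (hclosed : ∀ᶠ z in 𝓝 q, ∀ u v, fderiv ℂ η z u v = fderiv ℂ η z v u) :
    ∃ f : ℂ × ℂ → ℂ, AnalyticAt ℂ f q ∧ ∀ᶠ z in 𝓝 q, HasFDerivAt f (η z) z := by
  obtain ⟨ρ, hρ, hball⟩ := Metric.eventually_nhds_iff_ball.1 (hclosed.and hη.eventually_analyticAt)
  obtain ⟨f, hf⟩ := (convex_ball q ρ).exists_forall_hasFDerivAt_of_fderiv_symmetric
    Metric.isOpen_ball
    (fun z hz => ((hball z hz).2.differentiableAt.restrictScalars ℝ).differentiableWithinAt)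
    (fun z hz u v => by
      rw [(hball z hz).2.differentiableAt.fderiv_restrictScalars ℝ]
      exact (hball z hz).1 u v)
  have : ∀ᶠ z in 𝓝 q, HasFDerivAt f (η z) z :=
    Filter.mem_of_superset (Metric.ball_mem_nhds q hρ) fun z hz => hf z hz
  exact ⟨f, analyticAt_of_hasFDerivAt hη this, this⟩

end Primitive

/-! ### Vanishing of a specialized discriminant at multiple roots, infinity included. -/

noncomputable section FiberDiscriminant

section Discriminant

variable {R : Type*} [CommRing R] {K : Type*} [Field K]

theorem sum_fin_pow_mul_ite (N j m : ℕ) (h : j + m < N) (p : K) (c : ℕ → K) :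
    ∑ i : Fin N, p ^ (i : ℕ) * (if (i : ℕ) ∈ Set.Icc j (j + m) then c (i - j) else 0) =
      p ^ j * ∑ k ∈ Finset.range (m + 1), c k * p ^ k := by
  rw [Fin.sum_univ_eq_sum_range
    (fun i => p ^ i * (if i ∈ Set.Icc j (j + m) then c (i - j) else 0)) N]
  have hsub : Finset.Ico j (j + m + 1) ⊆ Finset.range N := by
    intro i hi
    simp only [Finset.mem_Ico, Finset.mem_range] at hi ⊢
    omega
  rw [← Finset.sum_subset hsub, Finset.sum_Ico_eq_sum_range, Finset.mul_sum]
  · have : j + m + 1 - j = m + 1 := by omega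
    rw [this]
    refine Finset.sum_congr rfl fun k hk => ?_
    have hk' := Finset.mem_range.1 hk
    rw [if_pos ⟨by omega, by omega⟩, Nat.add_sub_cancel_left]
    ring
  · intro i _ hi
    rw [if_neg, mul_zero]
    simp only [Finset.mem_Ico, Set.mem_Icc] at hi ⊢
    omega

/-- The columns of the Sylvester matrix list the coefficients of X^j f and X^j g, so pairing with
(1, p, p², …) evaluates these at p. The sums run to the formal degrees m, n, since leading
coefficients may drop under specialization. -/
theorem sylvester_vecMul_pow (f g : Polynomial K) (m n : ℕ) (p : K)
    (hf : ∑ k ∈ Finset.range (m + 1), f.coeff k * p ^ k = 0)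
    (hg : ∑ k ∈ Finset.range (n + 1), g.coeff k * p ^ k = 0) (j : Fin (m + n)) :
    ∑ i : Fin (m + n), p ^ (i : ℕ) * f.sylvester g m n i j = 0 := by
  induction j using Fin.addCases with
  | left j =>
    have := sum_fin_pow_mul_ite (m + n) j n (by omega) p g.coeff
    simp only [Polynomial.sylvester, Matrix.of_apply, Fin.addCases_left]
    rw [this, hg, mul_zero]
  | right j =>
    have := sum_fin_pow_mul_ite (m + n) j m (by omega) p f.coeff
    simp only [Polynomial.sylvester, Matrix.of_apply, Fin.addCases_right]
    rw [this, hf, mul_zero]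

theorem sum_coeff_eq_eval (f : Polynomial K) (n : ℕ) (h : f.natDegree ≤ n) (p : K) :
    ∑ k ∈ Finset.range (n + 1), f.coeff k * p ^ k = f.eval p := by
  rw [Polynomial.eval_eq_sum_range' (Nat.lt_succ_of_le h)]

/-- A common root of a specialization of `F` and of its derivative makes the specialized
discriminant vanish, even where the leading coefficient does. -/
theorem map_discr_eq_zero_of_common_root (F : Polynomial R) (ev : R →+* K) (hn : 2 ≤ F.natDegree)
    {p : K} (h₀ : (F.map ev).eval p = 0) (h₁ : (F.map ev).derivative.eval p = 0) :
    ev F.discr = 0 := by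
  set n := F.natDegree with hnd
  have hnd' : (F.map ev).natDegree ≤ n := Polynomial.natDegree_map_le
  have hS := sylvester_vecMul_pow (F.map ev).derivative (F.map ev) (n - 1) n p
    (by rw [sum_coeff_eq_eval _ _ ((Polynomial.natDegree_derivative_le _).trans (by omega)), h₁])
    (by rw [sum_coeff_eq_eval _ _ hnd', h₀])
  rw [Polynomial.derivative_map] at hS
  have hrow := Polynomial.sylvesterDeriv_updateRow F (by omega)
  set A := F.sylvesterDeriv with hA
  set i₀ : Fin (F.natDegree - 1 + F.natDegree) := ⟨2 * F.natDegree - 2, by omega⟩ with hi₀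
  have hdet : (ev.mapMatrix A).det = 0 := by
    rw [← Matrix.exists_vecMul_eq_zero_iff]
    -- Row i₀ of `sylvesterDeriv` is the Sylvester row with the leading coefficient divided out;
    -- weighting its entry by that coefficient restores it. Entry 0 is 1, so the vector is nonzero
    -- even where the leading coefficient vanishes.
    refine ⟨fun i => if i = i₀ then ev F.leadingCoeff * p ^ (i : ℕ) else p ^ (i : ℕ), ?_, ?_⟩
    · intro h
      have := congrFun h ⟨0, by omega⟩
      rw [if_neg] at this
      · simp at this
      · rw [hi₀, Fin.ext_iff]
        simp only
        omega
    · ext j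
      refine Eq.trans ?_ (hS j)
      simp only [Matrix.vecMul, dotProduct]
      refine Finset.sum_congr rfl fun i _ => ?_
      rw [Polynomial.sylvester_map_map, ← hrow]
      by_cases hi : i = i₀
      · subst hi
        simp only [if_true, RingHom.mapMatrix_apply, Matrix.map_apply, Matrix.updateRow_self,
          Pi.smul_apply, smul_eq_mul, map_mul]
        ring
      · simp only [if_neg hi, RingHom.mapMatrix_apply, Matrix.map_apply,
          Matrix.updateRow_ne hi]
  rw [Polynomial.discr, map_mul, RingHom.map_det, hdet, zero_mul]

/-- A double root at infinity of a specialization of `F` makes the specialized discriminant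
vanish. -/
theorem map_discr_eq_zero_of_double_infinity (F : Polynomial R) (ev : R →+* K)
    (hn : 2 ≤ F.natDegree) (h₀ : ev (F.coeff F.natDegree) = 0)
    (h₁ : ev (F.coeff (F.natDegree - 1)) = 0) : ev F.discr = 0 := by
  set n := F.natDegree with hnd
  have hrow := Polynomial.sylvesterDeriv_updateRow F (by omega)
  -- Row 2n - 3 only meets coefficients of F of index at least n - 1 and of its derivative of index
  -- at least n - 2, all specializing to 0.
  have hdet : (ev.mapMatrix F.sylvesterDeriv).det = 0 := by
    refine Matrix.det_eq_zero_of_row_eq_zero ⟨2 * F.natDegree - 3, by omega⟩ fun j => ?_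
    have hne : (⟨2 * F.natDegree - 3, by omega⟩ : Fin (F.natDegree - 1 + F.natDegree)) ≠
        ⟨2 * F.natDegree - 2, by omega⟩ := by
      rw [Ne, Fin.ext_iff]
      simp only
      omega
    have e : F.sylvesterDeriv ⟨2 * F.natDegree - 3, by omega⟩ j =
        F.derivative.sylvester F (F.natDegree - 1) F.natDegree ⟨2 * F.natDegree - 3, by omega⟩ j := by
      rw [← hrow, Matrix.updateRow_ne hne]
    rw [RingHom.mapMatrix_apply, Matrix.map_apply, e]
    have hc : ∀ k, n - 1 ≤ k → ev (F.coeff k) = 0 := by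
      intro k hk
      rcases lt_trichotomy k n with h | h | h
      · rw [show k = n - 1 by omega, h₁]
      · rw [h, h₀]
      · rw [Polynomial.coeff_eq_zero_of_natDegree_lt (by omega), map_zero]
    induction j using Fin.addCases with
    | left j =>
      simp only [Polynomial.sylvester, Matrix.of_apply, Fin.addCases_left]
      split_ifs
      · exact hc _ (by omega)
      · exact map_zero _
    | right j =>
      simp only [Polynomial.sylvester, Matrix.of_apply, Fin.addCases_right]
      split_ifs
      · rw [Polynomial.coeff_derivative, map_mul, hc _ (by omega), zero_mul]
      · exact map_zero _
  rw [Polynomial.discr, map_mul, RingHom.map_det, hdet, zero_mul]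

end Discriminant

end FiberDiscriminant

/-! ### Binary forms and the simplicity of their zeros off the discriminant. -/

noncomputable section BinaryForm

/-- The determinant of two vectors of `ℂ²`. -/
def wedge (v w : ℂ × ℂ) : ℂ := v.1 * w.2 - v.2 * w.1

/-! ### Binary forms -/

/-- The binary form `∑ cₖ w₂ᵏ w₁ⁿ⁻ᵏ`. -/
def formAt (c : ℕ → ℂ) (n : ℕ) (w : ℂ × ℂ) : ℂ :=
  ∑ k ∈ Finset.range (n + 1), c k * w.2 ^ k * w.1 ^ (n - k)

theorem formAt_smul (c : ℕ → ℂ) (n : ℕ) (t : ℂ) (w : ℂ × ℂ) :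
    formAt c n (t • w) = t ^ n * formAt c n w := by
  simp only [formAt, Finset.mul_sum]
  refine Finset.sum_congr rfl fun k hk => ?_
  have : t ^ n = t ^ k * t ^ (n - k) := by
    rw [← pow_add]; congr 1; have := Finset.mem_range.1 hk; omega
  simp only [Prod.smul_fst, Prod.smul_snd, smul_eq_mul, mul_pow, this]
  ring

/-- The partial derivative of a binary form in the first variable. -/
def formFst (c : ℕ → ℂ) (n : ℕ) (w : ℂ × ℂ) : ℂ :=
  ∑ k ∈ Finset.range (n + 1), c k * w.2 ^ k * (((n - k : ℕ) : ℂ) * w.1 ^ (n - k - 1))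

/-- The partial derivative of a binary form in the second variable. -/
def formSnd (c : ℕ → ℂ) (n : ℕ) (w : ℂ × ℂ) : ℂ :=
  ∑ k ∈ Finset.range (n + 1), c k * ((k : ℂ) * w.2 ^ (k - 1)) * w.1 ^ (n - k)

theorem natCast_mul_pow_pred_mul (k : ℕ) (x : ℂ) : (k : ℂ) * x ^ (k - 1) * x = k * x ^ k := by
  rcases k with _ | k
  · simp
  · rw [Nat.add_sub_cancel, pow_succ]; ring

theorem formAt_euler (c : ℕ → ℂ) (n : ℕ) (w : ℂ × ℂ) :
    w.1 * formFst c n w + w.2 * formSnd c n w = n * formAt c n w := by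
  simp only [formFst, formSnd, formAt, Finset.mul_sum, ← Finset.sum_add_distrib]
  refine Finset.sum_congr rfl fun k hk => ?_
  have h1 := natCast_mul_pow_pred_mul (n - k) w.1
  have h2 := natCast_mul_pow_pred_mul k w.2
  have h3 : (n : ℂ) = ((n - k : ℕ) : ℂ) + k := by
    rw [Nat.cast_sub (by have := Finset.mem_range.1 hk; omega)]; ring
  rw [h3]
  linear_combination c k * w.2 ^ k * h1 + c k * w.1 ^ (n - k) * h2

theorem hasDerivAt_formAt (c : ℕ → ℂ) (n : ℕ) (a b : ℂ → ℂ) (a' b' t : ℂ)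
    (ha : HasDerivAt a a' t) (hb : HasDerivAt b b' t) :
    HasDerivAt (fun t => formAt c n (a t, b t))
      (a' * formFst c n (a t, b t) + b' * formSnd c n (a t, b t)) t := by
  have : ∀ k ∈ Finset.range (n + 1), HasDerivAt (fun t => c k * b t ^ k * a t ^ (n - k))
      (c k * (k * b t ^ (k - 1) * b') * a t ^ (n - k) +
        c k * b t ^ k * (((n - k : ℕ) : ℂ) * a t ^ (n - k - 1) * a')) t := fun k _ =>
    ((hb.fun_pow k).const_mul (c k)).mul (ha.fun_pow (n - k))
  convert! HasDerivAt.fun_sum this using 1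
  simp only [formFst, formSnd, Finset.mul_sum, ← Finset.sum_add_distrib]
  refine Finset.sum_congr rfl fun k _ => ?_
  ring

variable {U : Opens (ℂ × ℂ)}

/-- Evaluation of holomorphic functions at a point. -/
def evalAt (q : U) : Holo U →+* ℂ where
  toFun f := (f : U → ℂ) q
  map_one' := rfl
  map_mul' _ _ := rfl
  map_zero' := rfl
  map_add' _ _ := rfl

theorem formAt_evalAt (F : Polynomial (Holo U)) (q : U) (w : ℂ × ℂ) :
    formAt (fun k => evalAt q (F.coeff k)) F.natDegree w = binaryForm F q w := rfl

/-- At a point of the regular locus the binary form has only simple zeros. -/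
theorem formAt_regular {F : Polynomial (Holo U)} (hd : 2 ≤ F.natDegree) {q : U}
    (hq : evalAt q F.discr ≠ 0) {w : ℂ × ℂ} (hw : w ≠ 0)
    (h₀ : formFst (fun k => evalAt q (F.coeff k)) F.natDegree w = 0)
    (h₁ : formSnd (fun k => evalAt q (F.coeff k)) F.natDegree w = 0) : False := by
  set n := F.natDegree with hn
  set c : ℕ → ℂ := fun k => evalAt q (F.coeff k) with hc
  have hn0 : (n : ℂ) ≠ 0 := by exact_mod_cast (by omega : n ≠ 0)
  have hform : formAt c n w = 0 := by
    have := formAt_euler c n w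
    rw [h₀, h₁] at this
    simpa [hn0] using this.symm
  -- The vertical direction is the root at infinity, governed by the two top coefficients; any other
  -- direction is the finite root w.2 / w.1.
  by_cases hw1 : w.1 = 0
  · have hw2 : w.2 ≠ 0 := fun h => hw (Prod.ext hw1 h)
    refine hq (map_discr_eq_zero_of_double_infinity F (evalAt q) hd ?_ ?_)
    · rw [formAt, Finset.sum_eq_single n] at hform
      · change c n = 0
        simpa [hw2] using hform
      · intro k hk hkn
        have := Finset.mem_range.1 hk
        rw [hw1, zero_pow (by omega), mul_zero]
      · simp
    · rw [formFst, Finset.sum_eq_single (n - 1)] at h₀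
      · have e : n - (n - 1) = 1 := by omega
        simpa [hw2, e] using h₀
      · intro k hk hkn
        have := Finset.mem_range.1 hk
        by_cases hk' : k = n
        · simp [hk']
        · rw [hw1, zero_pow (by omega), mul_zero, mul_zero]
      · intro h
        exact absurd (Finset.mem_range.2 (by omega)) h
  · have hnat : (F.map (evalAt q)).natDegree ≤ n := Polynomial.natDegree_map_le
    refine hq (map_discr_eq_zero_of_common_root F (evalAt q) hd (p := w.2 / w.1) ?_ ?_)
    · rw [← sum_coeff_eq_eval _ n hnat]
      rw [← mul_right_inj' (pow_ne_zero n hw1), mul_zero, ← hform, Finset.mul_sum, formAt]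
      refine Finset.sum_congr rfl fun k hk => ?_
      have : w.1 ^ n = w.1 ^ k * w.1 ^ (n - k) := by
        rw [← pow_add]; congr 1; have := Finset.mem_range.1 hk; omega
      rw [Polynomial.coeff_map, this, div_pow]
      change _ * (c k * _) = _
      field_simp
    · rw [← sum_coeff_eq_eval _ (n - 1) ((Polynomial.natDegree_derivative_le _).trans (by omega))]
      rw [← mul_right_inj' (pow_ne_zero (n - 1) hw1), mul_zero, ← h₁, Finset.mul_sum, formSnd,
        Finset.sum_range_succ' _ n, show n - 1 + 1 = n by omega]
      simp only [Nat.cast_zero, zero_mul, mul_zero, add_zero]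
      refine Finset.sum_congr rfl fun k hk => ?_
      have : w.1 ^ (n - 1) = w.1 ^ k * w.1 ^ (n - (k + 1)) := by
        rw [← pow_add]; congr 1; have := Finset.mem_range.1 hk; omega
      rw [Polynomial.coeff_derivative, Polynomial.coeff_map, this, div_pow, Nat.add_sub_cancel]
      change _ * (c (k + 1) * _ * _) = _
      push_cast
      field_simp

/-- The restriction of a binary form to the affine line through `(0, 1)` with direction
`(1, p)`. -/
def pencil (c : ℕ → ℂ) (n : ℕ) (p : ℂ) : Polynomial ℂ :=
  ∑ k ∈ Finset.range (n + 1),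
    Polynomial.C (c k) * (Polynomial.C p * Polynomial.X + Polynomial.C 1) ^ k *
      Polynomial.X ^ (n - k)

theorem pencil_eval (c : ℕ → ℂ) (n : ℕ) (p t : ℂ) :
    (pencil c n p).eval t = formAt c n (t, p * t + 1) := by
  simp [pencil, formAt, Polynomial.eval_finsetSum]

theorem pencil_natDegree_le (c : ℕ → ℂ) (n : ℕ) (p : ℂ) : (pencil c n p).natDegree ≤ n := by
  refine Polynomial.natDegree_sum_le_of_forall_le _ _ fun k hk => ?_
  have h1 : ((Polynomial.C p * Polynomial.X + Polynomial.C 1) ^ k).natDegree ≤ k * 1 :=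
    Polynomial.natDegree_pow_le_of_le k Polynomial.natDegree_linear_le
  have h2 := (Polynomial.natDegree_C_mul_le (c k) _).trans h1
  have h3 := Polynomial.natDegree_mul_le_of_le h2 (Polynomial.natDegree_X_pow_le (R := ℂ) (n - k))
  have := Finset.mem_range.1 hk
  omega

/-- (1, p) is the point at infinity of the affine line. If the form is nonzero there, the pencil has
full degree n and its roots see every zero direction, the vertical one being t = 0. -/
theorem pencil_coeff (c : ℕ → ℂ) (n : ℕ) (p : ℂ) :
    (pencil c n p).coeff n = formAt c n (1, p) := by
  rw [pencil, Polynomial.finsetSum_coeff, formAt]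
  refine Finset.sum_congr rfl fun k hk => ?_
  have hk' := Finset.mem_range.1 hk
  have e : n = k + (n - k) := by omega
  conv_lhs => rw [Polynomial.coeff_mul_X_pow', if_pos (by omega : n - k ≤ n),
    show n - (n - k) = k by omega, Polynomial.coeff_C_mul]
  have := Polynomial.coeff_pow_of_natDegree_le (m := k)
    (Polynomial.natDegree_linear_le (a := p) (b := (1 : ℂ)))
  rw [mul_one] at this
  rw [this]
  simp [Polynomial.coeff_one]

end BinaryForm

/-! ### Holomorphic local frames of web directions. -/

noncomputable section WebFrame

variable {U : Opens (ℂ × ℂ)}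

theorem exists_analytic_implicit {G : (ℂ × ℂ) × ℂ → ℂ} {q₀ : ℂ × ℂ} {t₀ d : ℂ}
    (hG : AnalyticAt ℂ G (q₀, t₀)) (h0 : G (q₀, t₀) = 0)
    (hd : HasDerivAt (fun t => G (q₀, t)) d t₀) (hne : d ≠ 0) :
    ∃ T : ℂ × ℂ → ℂ, AnalyticAt ℂ T q₀ ∧ T q₀ = t₀ ∧ ∀ᶠ q in 𝓝 q₀, G (q, T q) = 0 := by
  -- The exponent ⊤ is ω, so the implicit function obtained is analytic.
  have hc : ContDiffAt ℂ ⊤ G (q₀, t₀) := hG.contDiffAt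
  have hfd : HasFDerivAt G (fderiv ℂ G (q₀, t₀)) (q₀, t₀) := hG.differentiableAt.hasFDerivAt
  have h1 : fderiv ℂ G (q₀, t₀) (0, 1) = d := by
    have h2 : HasDerivAt (fun t : ℂ => (q₀, t)) ((0 : ℂ × ℂ), (1 : ℂ)) t₀ :=
      (hasDerivAt_const t₀ q₀).prodMk (hasDerivAt_id t₀)
    exact (hfd.comp_hasDerivAt t₀ h2).unique hd
  have hinv : (fderiv ℂ G (q₀, t₀) ∘L .inr ℂ (ℂ × ℂ) ℂ).IsInvertible := by
    refine ⟨ContinuousLinearEquiv.unitsEquivAut ℂ (Units.mk0 d hne), ?_⟩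
    ext
    simp [h1]
  have hT : (⊤ : WithTop ℕ∞) ≠ 0 := by simp
  refine ⟨hc.implicitFunction hT hinv, (hc.contDiffAt_implicitFunction hT hinv).analyticAt,
    hc.implicitFunction_apply_self hT hinv, ?_⟩
  have := hc.eventually_apply_implicitFunction hT hinv
  rw [h0] at this
  exact this

theorem evalAt_discr_ne_zero {F : Polynomial (Holo U)} {q : ℂ × ℂ} (hq : q ∈ regularLocus F) :
    evalAt ⟨q, hq.1⟩ F.discr ≠ 0 := fun h => hq.2 ⟨hq.1, h⟩

theorem wedge_ne_zero_of_ne {s t p : ℂ} (h : s ≠ t) : wedge (s, p * s + 1) (t, p * t + 1) ≠ 0 := by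
  simp only [wedge]
  intro h'
  exact h (by linear_combination h')

/-- Near a point of the regular locus, the zeros of the binary form are `d` distinct lines which
depend holomorphically on the point. -/
theorem exists_web_frame (F : Polynomial (Holo U)) (hd : 2 ≤ F.natDegree) {q₀ : ℂ × ℂ}
    (hq₀ : q₀ ∈ regularLocus F) :
    ∃ w : Fin F.natDegree → ℂ × ℂ → ℂ × ℂ, (∀ i, AnalyticAt ℂ (w i) q₀) ∧
      ∀ᶠ q in 𝓝 q₀, (∀ i j, i ≠ j → wedge (w i q) (w j q) ≠ 0) ∧
        ∀ (h : q ∈ U) (v : ℂ × ℂ), v ≠ 0 →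
          (binaryForm F ⟨q, h⟩ v = 0 ↔ ∃ i, wedge (w i q) v = 0) := by
  set n := F.natDegree with hn
  have hex : ∀ k, ∃ g : ℂ × ℂ → ℂ, AnalyticOnNhd ℂ g (U : Set (ℂ × ℂ)) ∧
      ∀ q : U, (F.coeff k : U → ℂ) q = g q := fun k => (F.coeff k).2
  choose c hc hce using hex
  have hreg := evalAt_discr_ne_zero hq₀
  have hU₀ : q₀ ∈ U := hq₀.1
  have hcoeff : ∀ (q : ℂ × ℂ) (h : q ∈ U),
      (fun k => evalAt ⟨q, h⟩ (F.coeff k)) = fun k => c k q := fun q h => funext fun k => hce k ⟨q, h⟩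
  have hform : ∀ (q : ℂ × ℂ) (h : q ∈ U) (v : ℂ × ℂ),
      binaryForm F ⟨q, h⟩ v = formAt (fun k => c k q) n v := fun q h v => by
    rw [← formAt_evalAt, hcoeff]
  have hsimple : ∀ v : ℂ × ℂ, v ≠ 0 → formFst (fun k => c k q₀) n v = 0 →
      formSnd (fun k => c k q₀) n v = 0 → False := fun v hv h₀ h₁ => by
    rw [← hcoeff q₀ hU₀] at h₀ h₁
    exact formAt_regular hd hreg hv h₀ h₁
  -- A form vanishing at every (1, p) would have both partial derivatives zero at (1, 0),
  -- contradicting simplicity.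
  obtain ⟨p, hp⟩ : ∃ p : ℂ, formAt (fun k => c k q₀) n (1, p) ≠ 0 := by
    by_contra! hcon
    have h1 : ∀ p : ℂ, formSnd (fun k => c k q₀) n (1, p) = 0 := fun p => by
      have h2 := hasDerivAt_formAt (fun k => c k q₀) n (fun _ => 1) (fun t => t) 0 1 p
        (hasDerivAt_const _ _) (hasDerivAt_id _)
      have h3 : (fun t : ℂ => formAt (fun k => c k q₀) n (1, t)) = fun _ => 0 := funext hcon
      rw [h3] at h2
      have := h2.unique (hasDerivAt_const p (0 : ℂ))
      simpa using this
    refine hsimple (1, 0) (by simp) ?_ (h1 0)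
    have := formAt_euler (fun k => c k q₀) n (1, 0)
    rw [hcon, h1] at this
    simpa using this
  set P : ℂ × ℂ → Polynomial ℂ := fun q => pencil (fun k => c k q) n p with hP
  have hev : ∀ q t, (P q).eval t = formAt (fun k => c k q) n (t, p * t + 1) := fun q t =>
    pencil_eval _ _ _ _
  have hdeg : ∀ q, formAt (fun k => c k q) n (1, p) ≠ 0 → (P q).natDegree = n := fun q hq =>
    le_antisymm (pencil_natDegree_le _ _ _)
      (Polynomial.le_natDegree_of_ne_zero (by rw [hP, pencil_coeff]; exact hq))
  have hder : ∀ q t, HasDerivAt (fun t => formAt (fun k => c k q) n (t, p * t + 1))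
      (formFst (fun k => c k q) n (t, p * t + 1) + p * formSnd (fun k => c k q) n (t, p * t + 1))
      t := fun q t => by
    have := hasDerivAt_formAt (fun k => c k q) n (fun t => t) (fun t => p * t + 1) 1 p t
      (hasDerivAt_id t) (by simpa using ((hasDerivAt_id t).const_mul p).add_const 1)
    simpa using this
  -- At a zero, Euler's relation kills the derivative along (t, pt + 1). If the derivative along the
  -- independent vector (1, p) vanished too, the zero would be multiple.
  have hder0 : ∀ t, formAt (fun k => c k q₀) n (t, p * t + 1) = 0 →
      formFst (fun k => c k q₀) n (t, p * t + 1) +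
        p * formSnd (fun k => c k q₀) n (t, p * t + 1) ≠ 0 := fun t ht hcon => by
    have h1 := formAt_euler (fun k => c k q₀) n (t, p * t + 1)
    rw [ht, mul_zero] at h1
    simp only at h1
    have h2 : formSnd (fun k => c k q₀) n (t, p * t + 1) = 0 := by
      linear_combination h1 - t * hcon
    have h3 : formFst (fun k => c k q₀) n (t, p * t + 1) = 0 := by
      linear_combination hcon - p * h2
    refine hsimple _ ?_ h3 h2
    intro h
    obtain ⟨h4, h5⟩ := Prod.mk.inj h
    rw [h4] at h5
    simp at h5
  have hP0 : P q₀ ≠ 0 := fun h => by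
    have := hdeg q₀ hp
    rw [h, Polynomial.natDegree_zero] at this
    omega
  have hnodup : (P q₀).roots.Nodup := by
    rw [Polynomial.nodup_roots_iff_of_splits hP0 (IsAlgClosed.splits _),
      Polynomial.separable_def, Polynomial.isCoprime_iff_aeval_ne_zero_of_isAlgClosed ℂ ℂ]
    intro t
    by_contra! hcon
    simp only [Polynomial.coe_aeval_eq_eval] at hcon
    have h1 := (P q₀).hasDerivAt t
    have h2 : (fun t => (P q₀).eval t) = fun t => formAt (fun k => c k q₀) n (t, p * t + 1) :=
      funext (hev q₀)
    rw [h2, hcon.2] at h1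
    exact hder0 t (by rw [← hev, hcon.1]) ((hder q₀ t).unique h1)
  have hcard : (P q₀).roots.toFinset.card = n := by
    rw [Multiset.toFinset_card_of_nodup hnodup, IsAlgClosed.card_roots_eq_natDegree, hdeg q₀ hp]
  obtain ⟨τ⟩ : Nonempty (Fin n ≃ (P q₀).roots.toFinset) :=
    ⟨(Finset.equivFinOfCardEq hcard).symm⟩
  have hτ : ∀ i, formAt (fun k => c k q₀) n ((τ i : ℂ), p * (τ i : ℂ) + 1) = 0 := fun i => by
    have := (τ i).2
    rw [Multiset.mem_toFinset, Polynomial.mem_roots hP0, Polynomial.IsRoot.def, hev] at this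
    exact this
  have hGan : ∀ (a b : (ℂ × ℂ) × ℂ → ℂ) (z : (ℂ × ℂ) × ℂ), z.1 ∈ U → AnalyticAt ℂ a z →
      AnalyticAt ℂ b z → AnalyticAt ℂ (fun z => formAt (fun k => c k z.1) n (a z, b z)) z := by
    intro a b z hz ha hb
    simp only [formAt]
    refine Finset.analyticAt_fun_sum _ fun k _ => ?_
    exact ((AnalyticAt.comp (g := c k) (f := Prod.fst) (hc k z.1 hz) analyticAt_fst).mul (hb.pow k)).mul (ha.pow _)
  have hT : ∀ i, ∃ T : ℂ × ℂ → ℂ, AnalyticAt ℂ T q₀ ∧ T q₀ = τ i ∧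
      ∀ᶠ q in 𝓝 q₀, formAt (fun k => c k q) n (T q, p * T q + 1) = 0 := fun i =>
    exists_analytic_implicit (G := fun z => formAt (fun k => c k z.1) n (z.2, p * z.2 + 1))
      (hGan _ _ _ hU₀ analyticAt_snd
        ((analyticAt_const.mul analyticAt_snd).add analyticAt_const)) (hτ i)
      (hder q₀ (τ i)) (hder0 _ (hτ i))
  choose T hTan hT0 hTz using hT
  refine ⟨fun i q => (T i q, p * T i q + 1), fun i =>
    (hTan i).prod ((analyticAt_const.mul (hTan i)).add analyticAt_const), ?_⟩
  have hlead : ∀ᶠ q in 𝓝 q₀, formAt (fun k => c k q) n (1, p) ≠ 0 := by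
    have : ContinuousAt (fun q => formAt (fun k => c k q) n (1, p)) q₀ := by
      simp only [formAt]
      refine tendsto_finsetSum _ fun k _ => ?_
      exact (((hc k q₀ hU₀).continuousAt).mul continuousAt_const).mul continuousAt_const
    exact this.eventually_ne hp
  have hdist : ∀ᶠ q in 𝓝 q₀, ∀ i j, i ≠ j → T i q ≠ T j q := by
    refine Filter.eventually_all.2 fun i => Filter.eventually_all.2 fun j => ?_
    by_cases hij : i = j
    · exact Filter.Eventually.of_forall fun q h => absurd hij h
    · have h1 : T i q₀ - T j q₀ ≠ 0 := by
        rw [hT0, hT0, sub_ne_zero]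
        exact fun h => hij (τ.injective (Subtype.ext h))
      filter_upwards [((hTan i).continuousAt.sub (hTan j).continuousAt).eventually_ne h1] with q hq _
      exact sub_ne_zero.1 hq
  filter_upwards [hlead, hdist, Filter.eventually_all.2 hTz] with q hq1 hq2 hq3
  have hPq : P q ≠ 0 := fun h => by
    have := hdeg q hq1
    rw [h, Polynomial.natDegree_zero] at this
    omega
  -- The n distinct roots T i q exhaust a polynomial of degree n.
  have hroots : ∀ t, (P q).eval t = 0 ↔ ∃ i, T i q = t := by
    have hinj : Function.Injective fun i => T i q := fun i j h => by
      by_contra hij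
      exact hq2 i j hij h
    have hsub : Finset.univ.image (fun i => T i q) ⊆ (P q).roots.toFinset := by
      intro t ht
      obtain ⟨i, -, rfl⟩ := Finset.mem_image.1 ht
      rw [Multiset.mem_toFinset, Polynomial.mem_roots hPq, Polynomial.IsRoot.def, hev]
      exact hq3 i
    have heq := Finset.eq_of_subset_of_card_le hsub (by
      rw [Finset.card_image_of_injective _ hinj, Finset.card_univ, Fintype.card_fin]
      exact (Multiset.toFinset_card_le _).trans ((Polynomial.card_roots' _).trans_eq (hdeg q hq1)))
    intro t
    have := congrArg (t ∈ ·) heq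
    simp only [Finset.mem_image, Finset.mem_univ, true_and, Multiset.mem_toFinset,
      Polynomial.mem_roots hPq, Polynomial.IsRoot.def, eq_iff_iff] at this
    exact this.symm
  refine ⟨fun i j hij => wedge_ne_zero_of_ne (hq2 i j hij), fun h v hv => ?_⟩
  rw [hform q h]
  set x := v.2 - p * v.1 with hx
  by_cases hx0 : x = 0
  · have hv1 : v.1 ≠ 0 := fun h1 => hv (Prod.ext h1 (by
      rw [hx, h1] at hx0
      simpa using hx0))
    have hv' : v = v.1 • ((1 : ℂ), p) := Prod.ext (by simp) (by
      simp only [Prod.smul_snd, smul_eq_mul]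
      linear_combination hx0)
    constructor
    · intro h0
      rw [hv', formAt_smul] at h0
      exact absurd h0 (mul_ne_zero (pow_ne_zero _ hv1) hq1)
    · rintro ⟨i, hi⟩
      simp only [wedge] at hi
      exact absurd (by linear_combination T i q * hx0 - hi) hv1
  · have hv' : v = x • (v.1 / x, p * (v.1 / x) + 1) := Prod.ext (by
        simp only [Prod.smul_fst, smul_eq_mul]; field_simp) (by
        simp only [Prod.smul_snd, smul_eq_mul]; field_simp; rw [hx]; ring)
    conv_lhs => rw [hv', formAt_smul, mul_eq_zero, ← hev, hroots]
    constructor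
    · rintro (h0 | ⟨i, hi⟩)
      · exact absurd h0 (pow_ne_zero _ hx0)
      · refine ⟨i, ?_⟩
        have : T i q * x = v.1 := by rw [hi]; field_simp
        simp only [wedge]
        rw [hx] at this
        linear_combination this
    · rintro ⟨i, hi⟩
      refine Or.inr ⟨i, ?_⟩
      rw [eq_div_iff hx0, hx]
      simp only [wedge] at hi
      linear_combination hi

end WebFrame

/-! ### Symmetries in terms of brackets with the frame. -/

noncomputable section SymmetryCriterion

open VectorField

variable {U : Opens (ℂ × ℂ)}

theorem wedge_add_right (u v w : ℂ × ℂ) : wedge u (v + w) = wedge u v + wedge u w := by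
  simp only [wedge, Prod.fst_add, Prod.snd_add]; ring

theorem wedge_smul_right (c : ℂ) (u v : ℂ × ℂ) : wedge u (c • v) = c * wedge u v := by
  simp only [wedge, Prod.smul_fst, Prod.smul_snd, smul_eq_mul]; ring

theorem wedge_self (u : ℂ × ℂ) : wedge u u = 0 := by simp only [wedge]; ring

theorem wedge_swap (u v : ℂ × ℂ) : wedge u v = -wedge v u := by simp only [wedge]; ring

/-- Two vectors parallel to the same nonzero vector are parallel. -/
theorem wedge_eq_zero_of_wedge {a u v : ℂ × ℂ} (ha : a ≠ 0) (hu : wedge a u = 0)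
    (hv : wedge a v = 0) : wedge u v = 0 := by
  simp only [wedge] at *
  by_cases h1 : a.1 = 0
  · have h2 : a.2 ≠ 0 := fun h => ha (Prod.ext h1 h)
    rw [h1] at hu hv
    have h3 : u.1 = 0 := by simpa [h2] using hu
    have h4 : v.1 = 0 := by simpa [h2] using hv
    rw [h3, h4]; ring
  · refine (mul_right_inj' h1).1 ?_
    linear_combination u.1 * hv - v.1 * hu

theorem exists_eq_smul_of_wedge {a v : ℂ × ℂ} (ha : a ≠ 0) (hv : wedge a v = 0) :
    ∃ c : ℂ, v = c • a := by
  simp only [wedge] at hv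
  by_cases h1 : a.1 = 0
  · have h2 : a.2 ≠ 0 := fun h => ha (Prod.ext h1 h)
    rw [h1] at hv
    have h4 : v.1 = 0 := by simpa [h2] using hv
    exact ⟨v.2 / a.2, Prod.ext (by simp [h1, h4]) (by simp [h2])⟩
  · refine ⟨v.1 / a.1, Prod.ext (by simp [h1]) ?_⟩
    simp only [Prod.smul_snd, smul_eq_mul]
    field_simp
    linear_combination hv

/-- The `1`-form `v ↦ det (a, v)`. -/
def wedgeForm (a : ℂ × ℂ) : ℂ × ℂ →L[ℂ] ℂ :=
  a.1 • ContinuousLinearMap.snd ℂ ℂ ℂ - a.2 • ContinuousLinearMap.fst ℂ ℂ ℂ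

@[simp] theorem wedgeForm_apply (a v : ℂ × ℂ) : wedgeForm a v = wedge a v := by
  simp [wedgeForm, wedge]

theorem analyticAt_wedgeForm {w : ℂ × ℂ → ℂ × ℂ} {q : ℂ × ℂ} (hw : AnalyticAt ℂ w q) :
    AnalyticAt ℂ (fun z => wedgeForm (w z)) q := by
  have h1 : AnalyticAt ℂ (fun z => (w z).1) q := analyticAt_fst.comp hw
  have h2 : AnalyticAt ℂ (fun z => (w z).2) q := analyticAt_snd.comp hw
  exact (h1.smul analyticAt_const).sub (h2.smul analyticAt_const)

/-- Differentiating η(w) = 0 along X trades (D_X η)(w) for -η(D_X w); the other derivatives of η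
cancel in the Cartan formula. -/
theorem lieDeriv_tangent {X w : ℂ × ℂ → ℂ × ℂ} {η : ℂ × ℂ → (ℂ × ℂ →L[ℂ] ℂ)} {q : ℂ × ℂ}
    (hX : DifferentiableAt ℂ X q) (hw : DifferentiableAt ℂ w q) (hη : DifferentiableAt ℂ η q)
    (h0 : ∀ᶠ z in 𝓝 q, η z (w z) = 0) :
    lieDeriv X η q (w q) = -η q (lieBracket ℂ X w q) := by
  have h1 : fderiv ℂ (fun z => η z (w z)) q (X q) = 0 := by
    have : (fun z => η z (w z)) =ᶠ[𝓝 q] fun _ => 0 := h0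
    rw [this.fderiv_eq]
    simp
  rw [fderiv_clm_apply hη hw] at h1
  rw [lieDeriv, fderiv_clm_apply hη hX, lieBracket]
  simp only [add_apply, ContinuousLinearMap.comp_apply, ContinuousLinearMap.flip_apply,
    map_sub] at h1 ⊢
  linear_combination h1

/-- `w` is a local frame of directions of the web of `F` near `q`. -/
def IsFrameAt (F : Polynomial (Holo U)) {ι : Type} (w : ι → ℂ × ℂ → ℂ × ℂ) (q : ℂ × ℂ) : Prop :=
  (∀ i, AnalyticAt ℂ (w i) q) ∧
    ∀ᶠ q' in 𝓝 q, q' ∈ U ∧ (∀ i j, i ≠ j → wedge (w i q') (w j q') ≠ 0) ∧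
      ∀ (h : q' ∈ U) (v : ℂ × ℂ), v ≠ 0 →
        (binaryForm F ⟨q', h⟩ v = 0 ↔ ∃ i, wedge (w i q') v = 0)

theorem IsFrameAt.ne_zero {F : Polynomial (Holo U)} {ι : Type} [Nontrivial ι]
    {w : ι → ℂ × ℂ → ℂ × ℂ} {q : ℂ × ℂ} (h : IsFrameAt F w q) (i : ι) : w i q ≠ 0 := by
  obtain ⟨j, hj⟩ := exists_ne i
  intro h0
  have := h.2.self_of_nhds.2.1 i j hj.symm
  rw [h0] at this
  simp [wedge] at this

theorem IsFrameAt.eventually {F : Polynomial (Holo U)} {ι : Type} [Finite ι]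
    {w : ι → ℂ × ℂ → ℂ × ℂ} {q : ℂ × ℂ} (h : IsFrameAt F w q) :
    ∀ᶠ q' in 𝓝 q, IsFrameAt F w q' := by
  filter_upwards [Filter.eventually_all.2 fun i => (h.1 i).eventually_analyticAt,
    h.2.eventually_nhds] with q' h1 h2
  exact ⟨h1, h2⟩

/-- The symmetries of the web are the vector fields whose bracket with each direction of the web
is parallel to that direction. -/
theorem isSymmetryAt_iff {F : Polynomial (Holo U)} {ι : Type} [Finite ι] [Nontrivial ι]
    {w : ι → ℂ × ℂ → ℂ × ℂ} {q : ℂ × ℂ} (hw : IsFrameAt F w q) (X : ℂ × ℂ → ℂ × ℂ) :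
    IsSymmetryAt F X q ↔
      AnalyticAt ℂ X q ∧ ∀ i, wedge (w i q) (lieBracket ℂ X (w i) q) = 0 := by
  constructor
  · rintro ⟨hX, hs⟩
    refine ⟨hX, fun i => ?_⟩
    have hform : IsWebFormAt F (fun z => wedgeForm (w i z)) q := by
      refine ⟨analyticAt_wedgeForm (hw.1 i), ?_⟩
      filter_upwards [hw.2, hw.eventually] with z hz hz'
      refine ⟨fun h0 => hz'.ne_zero i ?_, fun h v hv => ?_⟩
      · have h1 := congrArg (fun f : ℂ × ℂ →L[ℂ] ℂ => f (1, 0)) h0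
        have h2 := congrArg (fun f : ℂ × ℂ →L[ℂ] ℂ => f (0, 1)) h0
        simp only [wedgeForm_apply, wedge, zero_apply, mul_one, mul_zero, zero_sub,
          sub_zero, neg_eq_zero] at h1 h2
        exact Prod.ext h2 h1
      -- `IsWebFormAt` also tests v = 0, which the frame condition leaves out.
      · by_cases hv0 : v = 0
        · obtain ⟨j, hj⟩ := exists_ne i
          have h1 : binaryForm F ⟨z, h⟩ (w i z) = 0 :=
            (hz.2.2 h _ (hz'.ne_zero i)).2 ⟨i, wedge_self _⟩
          by_cases hn : F.natDegree = 0
          · have hall : ∀ u, binaryForm F ⟨z, h⟩ u = binaryForm F ⟨z, h⟩ (w i z) := fun u => by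
              simp [binaryForm, hn]
            rw [hall, h1]
          · have := formAt_smul (fun k => evalAt ⟨z, h⟩ (F.coeff k)) F.natDegree 0 v
            rw [zero_smul, zero_pow hn, zero_mul, formAt_evalAt] at this
            rw [hv0, this]
        · exact (hz.2.2 h v hv0).2 ⟨i, by simpa using hv⟩
    have h1 := lieDeriv_tangent hX.differentiableAt (hw.1 i).differentiableAt
      (analyticAt_wedgeForm (hw.1 i)).differentiableAt
      (Filter.Eventually.of_forall fun z => by simp [wedge_self])
    obtain ⟨j, hj⟩ := exists_ne i
    have h2 := hs _ hform (w i q) (w j q)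
    simp only [wedgeForm_apply, wedge_self, mul_zero, sub_zero] at h2 h1
    rw [h1] at h2
    have h3 := hw.2.self_of_nhds.2.1 i j hj.symm
    simpa [h3] using h2
  · rintro ⟨hX, hs⟩
    refine ⟨hX, fun η hη v u => ?_⟩
    -- This vector spans the kernel of η, hence is parallel to some direction of the frame.
    have hκ : ∀ z, η z ≠ 0 → ((-η z (0, 1), η z (1, 0)) : ℂ × ℂ) ≠ 0 := fun z hz h0 => by
      refine hz ?_
      obtain ⟨h1, h2⟩ := Prod.mk.inj h0
      ext
      · simpa using h2
      · simpa using h1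
    have happ : ∀ z v, η z v = wedge (-η z (0, 1), η z (1, 0)) v * (-1) := fun z v => by
      have : v = v.1 • ((1 : ℂ), (0 : ℂ)) + v.2 • ((0 : ℂ), (1 : ℂ)) := by ext <;> simp
      conv_lhs => rw [this, map_add, map_smul, map_smul]
      simp only [wedge, smul_eq_mul]
      ring
    have hcov : ∀ᶠ z in 𝓝 q, ∃ i, wedge (w i z) (-η z (0, 1), η z (1, 0)) = 0 := by
      filter_upwards [hw.2, hη.2] with z hz hz'
      refine (hz.2.2 hz.1 _ (hκ z hz'.1)).1 (hz'.2 hz.1 _ ?_)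
      rw [happ, wedge_self, zero_mul]
    obtain ⟨i, hi⟩ := hcov.self_of_nhds
    have hcont : ∀ j, ContinuousAt (fun z => wedge (w j z) (-η z (0, 1), η z (1, 0))) q := by
      intro j
      have h1 := (hw.1 j).continuousAt
      have h2 := hη.1.continuousAt
      have h3 : ContinuousAt (fun z => η z (0, 1)) q := h2.clm_apply continuousAt_const
      have h4 : ContinuousAt (fun z => η z (1, 0)) q := h2.clm_apply continuousAt_const
      simp only [wedge]
      exact (h1.fst.mul h4).sub (h1.snd.mul h3.neg)
    have hne : ∀ j, j ≠ i → wedge (w j q) (-η q (0, 1), η q (1, 0)) ≠ 0 := by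
      intro j hj h0
      refine hw.2.self_of_nhds.2.1 i j hj.symm ?_
      refine wedge_eq_zero_of_wedge (hκ q hη.2.self_of_nhds.1) ?_ ?_
      · rw [wedge_swap, hi, neg_zero]
      · rw [wedge_swap, h0, neg_zero]
    -- The index of the direction killed by η could a priori jump; continuity and pairwise
    -- independence fix it near q.
    have hnear : ∀ᶠ z in 𝓝 q, η z (w i z) = 0 := by
      have h1 : ∀ᶠ z in 𝓝 q, ∀ j, j ≠ i → wedge (w j z) (-η z (0, 1), η z (1, 0)) ≠ 0 := by
        refine Filter.eventually_all.2 fun j => ?_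
        by_cases hj : j = i
        · exact Filter.Eventually.of_forall fun z h => absurd hj h
        · exact ((hcont j).eventually_ne (hne j hj)).mono fun z hz _ => hz
      filter_upwards [h1, hcov] with z hz1 hz2
      obtain ⟨j, hj⟩ := hz2
      have : j = i := by
        by_contra h
        exact hz1 j h hj
      rw [happ, wedge_swap, ← this, hj]
      simp
    have h1 := lieDeriv_tangent hX.differentiableAt (hw.1 i).differentiableAt
      hη.1.differentiableAt hnear
    have hw0 := hw.ne_zero i
    obtain ⟨c, hc⟩ := exists_eq_smul_of_wedge hw0 (hs i)
    rw [hc, map_smul, hnear.self_of_nhds, smul_zero, neg_zero] at h1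
    have hlin : ∀ a, lieDeriv X η q a = (fderiv ℂ η q (X q) - (fderiv ℂ η q).flip (X q) +
        fderiv ℂ (fun q' => η q' (X q')) q) a := fun a => by
      simp [lieDeriv]
    generalize hL : (fderiv ℂ η q (X q) - (fderiv ℂ η q).flip (X q) +
        fderiv ℂ (fun q' => η q' (X q')) q) = L at hlin
    rw [hlin] at h1
    rw [hlin, hlin]
    have hz := hnear.self_of_nhds
    have ex : ∀ (f : ℂ × ℂ →L[ℂ] ℂ) (v : ℂ × ℂ), f v = v.1 * f (1, 0) + v.2 * f (0, 1) := by
      intro f v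
      have : v = v.1 • ((1 : ℂ), (0 : ℂ)) + v.2 • ((0 : ℂ), (1 : ℂ)) := by ext <;> simp
      conv_lhs => rw [this, map_add, map_smul, map_smul]
      simp
    -- The covectors ℒ_X η and η both annihilate w i q ≠ 0, so they are proportional.
    have h2 : L (1, 0) * η q (0, 1) - L (0, 1) * η q (1, 0) = 0 := by
      rw [ex] at h1 hz
      by_cases ha : (w i q).1 = 0
      · have hb : (w i q).2 ≠ 0 := fun h => hw0 (Prod.ext ha h)
        refine (mul_right_inj' hb).1 ?_
        linear_combination L (1, 0) * hz - η q (1, 0) * h1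
      · refine (mul_right_inj' ha).1 ?_
        linear_combination η q (0, 1) * h1 - L (0, 1) * hz
    rw [ex L v, ex L u, ex (η q) v, ex (η q) u]
    linear_combination (v.1 * u.2 - v.2 * u.1) * h2

end SymmetryCriterion

/-! ### Prolongation to a closed linear system in three unknowns. -/

noncomputable section Prolongation

open VectorField

theorem analyticOnNhd_clm {E G H : Type*} [NormedAddCommGroup E] [NormedSpace ℂ E]
    [NormedAddCommGroup G] [NormedSpace ℂ G] [FiniteDimensional ℂ G]
    [NormedAddCommGroup H] [NormedSpace ℂ H] [CompleteSpace H]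
    {f : E → G →L[ℂ] H} {s : Set E} (hs : IsOpen s)
    (h : ∀ v, AnalyticOnNhd ℂ (fun z => f z v) s) : AnalyticOnNhd ℂ f s := by
  have : ContDiffOn ℂ ⊤ f s :=
    contDiffOn_clm_apply.2 fun v z hz => (h v z hz).contDiffAt.contDiffWithinAt
  exact fun z hz => ((this z hz).contDiffAt (hs.mem_nhds hz)).analyticAt

/-! ### The prolonged system -/

/-- The connection of the prolongation of the system
`X₁ₓ = γ, X₁ᵧ = a(X), X₂ₓ = b(X), X₂ᵧ = γ + k(X)` in the unknowns `(X, γ)`, as a bilinear map. -/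
def prolongₗ (a b k : ℂ × ℂ → (ℂ × ℂ →L[ℂ] ℂ)) (z : ℂ × ℂ) :
    ((ℂ × ℂ) × ℂ) →ₗ[ℂ] (ℂ × ℂ) →ₗ[ℂ] ((ℂ × ℂ) × ℂ) :=
  LinearMap.mk₂ ℂ (fun s v =>
    ((v.1 * s.2 + v.2 * a z s.1, v.1 * b z s.1 + v.2 * (s.2 + k z s.1)),
      v.1 * (fderiv ℂ b z (0, 1) s.1 + b z (a z s.1, s.2 + k z s.1)
        - fderiv ℂ k z (1, 0) s.1 - k z (s.2, b z s.1)) +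
      v.2 * (fderiv ℂ a z (1, 0) s.1 + a z (s.2, b z s.1))))
    (by
      intro s t v
      have e1 : ∀ f : ℂ × ℂ →L[ℂ] ℂ, f (a z (s.1 + t.1), s.2 + t.2 + k z (s.1 + t.1)) =
          f (a z s.1, s.2 + k z s.1) + f (a z t.1, t.2 + k z t.1) := fun f => by
        rw [← map_add]; congr 1; ext <;> simp; ring
      have e2 : ∀ f : ℂ × ℂ →L[ℂ] ℂ, f (s.2 + t.2, b z (s.1 + t.1)) =
          f (s.2, b z s.1) + f (t.2, b z t.1) := fun f => by
        rw [← map_add]; congr 1; ext <;> simp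
      simp only [Prod.fst_add, Prod.snd_add, e1, e2]
      simp only [map_add]
      ext <;> simp <;> ring)
    (by
      intro c s v
      have e1 : ∀ f : ℂ × ℂ →L[ℂ] ℂ, f (a z (c • s.1), c • s.2 + k z (c • s.1)) =
          c * f (a z s.1, s.2 + k z s.1) := fun f => by
        rw [← smul_eq_mul, ← map_smul]; congr 1; ext <;> simp; ring
      have e2 : ∀ f : ℂ × ℂ →L[ℂ] ℂ, f (c • s.2, b z (c • s.1)) =
          c * f (s.2, b z s.1) := fun f => by
        rw [← smul_eq_mul, ← map_smul]; congr 1; ext <;> simp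
      simp only [Prod.smul_fst, Prod.smul_snd, e1, e2]
      simp only [map_smul]
      ext <;> simp <;> ring)
    (by
      intro s u v
      ext <;> simp <;> ring)
    (by
      intro c s v
      ext <;> simp <;> ring)

/-- The connection of the prolongation, as a continuous bilinear map. -/
def prolong (a b k : ℂ × ℂ → (ℂ × ℂ →L[ℂ] ℂ)) (z : ℂ × ℂ) :
    ((ℂ × ℂ) × ℂ) →L[ℂ] (ℂ × ℂ →L[ℂ] (ℂ × ℂ) × ℂ) :=
  LinearMap.toContinuousLinearMap
    ((LinearMap.toContinuousLinearMap : ((ℂ × ℂ) →ₗ[ℂ] ((ℂ × ℂ) × ℂ)) ≃ₗ[ℂ] _).toLinearMap ∘ₗ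
      prolongₗ a b k z)

theorem prolong_apply (a b k : ℂ × ℂ → (ℂ × ℂ →L[ℂ] ℂ)) (z : ℂ × ℂ) (s : (ℂ × ℂ) × ℂ)
    (v : ℂ × ℂ) : prolong a b k z s v =
    ((v.1 * s.2 + v.2 * a z s.1, v.1 * b z s.1 + v.2 * (s.2 + k z s.1)),
      v.1 * (fderiv ℂ b z (0, 1) s.1 + b z (a z s.1, s.2 + k z s.1)
        - fderiv ℂ k z (1, 0) s.1 - k z (s.2, b z s.1)) +
      v.2 * (fderiv ℂ a z (1, 0) s.1 + a z (s.2, b z s.1))) := rfl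

theorem analyticOnNhd_prolong {a b k : ℂ × ℂ → (ℂ × ℂ →L[ℂ] ℂ)} {V : Set (ℂ × ℂ)}
    (hV : IsOpen V) (ha : AnalyticOnNhd ℂ a V) (hb : AnalyticOnNhd ℂ b V)
    (hk : AnalyticOnNhd ℂ k V) : AnalyticOnNhd ℂ (prolong a b k) V := by
  refine analyticOnNhd_clm hV fun s => analyticOnNhd_clm hV fun v => ?_
  simp only [prolong_apply]
  intro z hz
  have hA : ∀ {f : ℂ × ℂ → (ℂ × ℂ →L[ℂ] ℂ)} {g : ℂ × ℂ → ℂ × ℂ}, AnalyticAt ℂ f z →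
      AnalyticAt ℂ g z → AnalyticAt ℂ (fun z => f z (g z)) z := fun hf hg =>
    analyticAt_clm_apply hf hg
  have ha' := hA (ha z hz) (analyticAt_const (v := s.1))
  have hb' := hA (hb z hz) (analyticAt_const (v := s.1))
  have hk' := hA (hk z hz) (analyticAt_const (v := s.1))
  have hda : AnalyticAt ℂ (fun z => fderiv ℂ a z (1, 0) s.1) z :=
    hA (analyticAt_clm_apply ((ha z hz).fderiv) analyticAt_const) analyticAt_const
  have hdb : AnalyticAt ℂ (fun z => fderiv ℂ b z (0, 1) s.1) z :=
    hA (analyticAt_clm_apply ((hb z hz).fderiv) analyticAt_const) analyticAt_const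
  have hdk : AnalyticAt ℂ (fun z => fderiv ℂ k z (1, 0) s.1) z :=
    hA (analyticAt_clm_apply ((hk z hz).fderiv) analyticAt_const) analyticAt_const
  have hc : ∀ c : ℂ, AnalyticAt ℂ (fun _ : ℂ × ℂ => c) z := fun c => analyticAt_const
  have h1 := hA (ha z hz) ((hc s.2).prod hb')
  have h2 := hA (hk z hz) ((hc s.2).prod hb')
  have h3 := hA (hb z hz) (ha'.prod ((hc s.2).add hk'))
  exact ((((hc _).mul (hc _)).add ((hc _).mul ha')).prod
    (((hc _).mul hb').add ((hc _).mul ((hc _).add hk')))).prod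
    (((hc _).mul (((hdb.add h3).sub hdk).sub h2)).add ((hc _).mul (hda.add h1)))

/-- A solution of the first order system, completed by `γ`, is flat for the prolongation. -/
theorem fderiv_prolong {a b k : ℂ × ℂ → (ℂ × ℂ →L[ℂ] ℂ)} {X : ℂ × ℂ → ℂ × ℂ} {q : ℂ × ℂ}
    (ha : AnalyticAt ℂ a q) (hb : AnalyticAt ℂ b q) (hk : AnalyticAt ℂ k q)
    (hX : AnalyticAt ℂ X q)
    (h1 : ∀ᶠ z in 𝓝 q, (fderiv ℂ X z (0, 1)).1 = a z (X z))
    (h2 : ∀ᶠ z in 𝓝 q, (fderiv ℂ X z (1, 0)).2 = b z (X z))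
    (h3 : ∀ᶠ z in 𝓝 q, (fderiv ℂ X z (0, 1)).2 = (fderiv ℂ X z (1, 0)).1 + k z (X z)) :
    fderiv ℂ (fun z => (X z, (fderiv ℂ X z (1, 0)).1)) q =
      prolong a b k q (X q, (fderiv ℂ X q (1, 0)).1) := by
  have hdX := hX.fderiv.differentiableAt
  have hsymm : ∀ u v, fderiv ℂ (fderiv ℂ X) q u v = fderiv ℂ (fderiv ℂ X) q v u := by
    intro u v
    exact (hX.contDiffAt (n := ⊤)).isSymmSndFDerivAt (by simp) u v
  have happ : ∀ u v, fderiv ℂ (fun z => fderiv ℂ X z v) q u = fderiv ℂ (fderiv ℂ X) q u v := by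
    intro u v
    rw [fderiv_clm_apply hdX (differentiableAt_const v)]
    simp
  have hd : ∀ v, DifferentiableAt ℂ (fun z => fderiv ℂ X z v) q := fun v =>
    hdX.clm_apply (differentiableAt_const v)
  have hfst : ∀ u v, fderiv ℂ (fun z => (fderiv ℂ X z v).1) q u =
      (fderiv ℂ (fderiv ℂ X) q u v).1 := fun u v => by
    rw [fderiv.fst (hd v), ← happ]; rfl
  have hsnd : ∀ u v, fderiv ℂ (fun z => (fderiv ℂ X z v).2) q u =
      (fderiv ℂ (fderiv ℂ X) q u v).2 := fun u v => by
    rw [fderiv.snd (hd v), ← happ]; rfl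
  have hclm : ∀ {f : ℂ × ℂ → (ℂ × ℂ →L[ℂ] ℂ)}, AnalyticAt ℂ f q → ∀ u,
      fderiv ℂ (fun z => f z (X z)) q u = fderiv ℂ f q u (X q) + f q (fderiv ℂ X q u) :=
    fun hf u => by
      rw [fderiv_clm_apply hf.differentiableAt hX.differentiableAt]
      simp [add_comm]
  have hdiff : ∀ {f : ℂ × ℂ → (ℂ × ℂ →L[ℂ] ℂ)}, AnalyticAt ℂ f q →
      DifferentiableAt ℂ (fun z => f z (X z)) q := fun hf =>
    hf.differentiableAt.clm_apply hX.differentiableAt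
  have e1 : fderiv ℂ X q (1, 0) = ((fderiv ℂ X q (1, 0)).1, b q (X q)) :=
    Prod.ext rfl h2.self_of_nhds
  have e2 : fderiv ℂ X q (0, 1) = (a q (X q), (fderiv ℂ X q (1, 0)).1 + k q (X q)) :=
    Prod.ext h1.self_of_nhds h3.self_of_nhds
  set γ := (fderiv ℂ X q (1, 0)).1 with hγ
  -- Symmetry of second derivatives closes the system: ∂ᵧγ = ∂ₓ(a(X)), and below ∂ₓγ = ∂ₓ(∂ᵧX₂ -
  -- k(X)) = ∂ᵧ(b(X)) - ∂ₓ(k(X)).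
  have gy : fderiv ℂ (fun z => (fderiv ℂ X z (1, 0)).1) q (0, 1) =
      fderiv ℂ a q (1, 0) (X q) + a q (γ, b q (X q)) := by
    rw [hfst, hsymm, ← hfst]
    have : (fun z => (fderiv ℂ X z (0, 1)).1) =ᶠ[𝓝 q] fun z => a z (X z) := h1
    rw [this.fderiv_eq, hclm ha, e1]
  have gx : fderiv ℂ (fun z => (fderiv ℂ X z (1, 0)).1) q (1, 0) =
      fderiv ℂ b q (0, 1) (X q) + b q (a q (X q), γ + k q (X q)) -
        fderiv ℂ k q (1, 0) (X q) - k q (γ, b q (X q)) := by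
    have : (fun z => (fderiv ℂ X z (0, 1)).2) =ᶠ[𝓝 q]
      fun z => (fderiv ℂ X z (1, 0)).1 + k z (X z) := h3
    have h4 := congrArg (fun L => L (1, 0)) (this.fderiv_eq (𝕜 := ℂ))
    rw [fderiv_fun_add (hd _).fst (hdiff hk), add_apply, hclm hk, hsnd, hsymm, ← hsnd] at h4
    have : (fun z => (fderiv ℂ X z (1, 0)).2) =ᶠ[𝓝 q] fun z => b z (X z) := h2
    rw [this.fderiv_eq, hclm hb, e1, e2] at h4
    linear_combination -h4
  have hvec : ∀ v : ℂ × ℂ, v = v.1 • ((1 : ℂ), (0 : ℂ)) + v.2 • ((0 : ℂ), (1 : ℂ)) := fun v => by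
    ext <;> simp
  refine ContinuousLinearMap.ext fun v => ?_
  rw [prolong_apply]
  rw [DifferentiableAt.fderiv_prodMk hX.differentiableAt (hd _).fst]
  simp only [ContinuousLinearMap.prod_apply]
  conv_lhs => rw [hvec v]
  simp only [map_add, map_smul, gx, gy, e1, e2]
  ext <;> simp

end Prolongation

/-! ### The connection attached to three foliations. -/

noncomputable section Connection

open VectorField

variable {U : Opens (ℂ × ℂ)}

/-- The Lagrange basis polynomial of binary quadratic forms attached to three directions. -/
def lagrange (u v w x : ℂ × ℂ) : ℂ := wedge x v * wedge x w / (wedge u v * wedge u w)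

/-- x ↦ det(x, D x) is a binary quadratic form, so its values at three pairwise independent vectors
determine it; this is what requires three foliations. -/
theorem lagrange_interpolation (D : ℂ × ℂ →L[ℂ] ℂ × ℂ) {u v w : ℂ × ℂ} (huv : wedge u v ≠ 0)
    (hvw : wedge v w ≠ 0) (hwu : wedge w u ≠ 0) (x : ℂ × ℂ) :
    wedge x (D x) = lagrange u v w x * wedge u (D u) + lagrange v w u x * wedge v (D v) +
      lagrange w u v x * wedge w (D w) := by
  have hD : ∀ x : ℂ × ℂ, D x = (x.1 * (D (1, 0)).1 + x.2 * (D (0, 1)).1,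
      x.1 * (D (1, 0)).2 + x.2 * (D (0, 1)).2) := fun x => by
    have : x = x.1 • ((1 : ℂ), (0 : ℂ)) + x.2 • ((0 : ℂ), (1 : ℂ)) := by ext <;> simp
    conv_lhs => rw [this, map_add, map_smul, map_smul]
    ext <;> simp
  have hvu : wedge v u = -wedge u v := wedge_swap _ _
  have hwv : wedge w v = -wedge v w := wedge_swap _ _
  have huw : wedge u w = -wedge w u := wedge_swap _ _
  rw [hD x, hD u, hD v, hD w]
  simp only [lagrange, hvu, hwv, huw]
  generalize (D (1, 0)).1 = m₁₁
  generalize (D (0, 1)).1 = m₁₂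
  generalize (D (1, 0)).2 = m₂₁
  generalize (D (0, 1)).2 = m₂₂
  field_simp
  simp only [wedge]
  ring

/-- The quadratic form `x ↦ det (x, DX x)` of a symmetry `X`, as a function of the value of
`X`. -/
def symbolForm (u v w : ℂ × ℂ → ℂ × ℂ) (x z : ℂ × ℂ) : ℂ × ℂ →L[ℂ] ℂ :=
  lagrange (u z) (v z) (w z) x • (wedgeForm (u z) ∘L fderiv ℂ u z) +
    lagrange (v z) (w z) (u z) x • (wedgeForm (v z) ∘L fderiv ℂ v z) +
    lagrange (w z) (u z) (v z) x • (wedgeForm (w z) ∘L fderiv ℂ w z)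

theorem analyticAt_wedge {u v : ℂ × ℂ → ℂ × ℂ} {z : ℂ × ℂ} (hu : AnalyticAt ℂ u z)
    (hv : AnalyticAt ℂ v z) : AnalyticAt ℂ (fun z => wedge (u z) (v z)) z := by
  simp only [wedge]
  exact ((analyticAt_fst.comp hu).mul (analyticAt_snd.comp hv)).sub
    ((analyticAt_snd.comp hu).mul (analyticAt_fst.comp hv))

theorem analyticAt_lagrange {u v w : ℂ × ℂ → ℂ × ℂ} {z : ℂ × ℂ} (hu : AnalyticAt ℂ u z)
    (hv : AnalyticAt ℂ v z) (hw : AnalyticAt ℂ w z) (huv : wedge (u z) (v z) ≠ 0)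
    (huw : wedge (u z) (w z) ≠ 0) (x : ℂ × ℂ) :
    AnalyticAt ℂ (fun z => lagrange (u z) (v z) (w z) x) z := by
  simp only [lagrange]
  exact ((analyticAt_wedge analyticAt_const hv).mul (analyticAt_wedge analyticAt_const hw)).div
    ((analyticAt_wedge hu hv).mul (analyticAt_wedge hu hw)) (mul_ne_zero huv huw)

theorem wedge_ne_zero_symm {u v : ℂ × ℂ} (h : wedge u v ≠ 0) : wedge v u ≠ 0 := by
  rw [wedge_swap]
  exact neg_ne_zero.2 h

theorem analyticOnNhd_symbolForm {u v w : ℂ × ℂ → ℂ × ℂ} {V : Set (ℂ × ℂ)} (hV : IsOpen V)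
    (hu : AnalyticOnNhd ℂ u V) (hv : AnalyticOnNhd ℂ v V) (hw : AnalyticOnNhd ℂ w V)
    (huv : ∀ z ∈ V, wedge (u z) (v z) ≠ 0) (hvw : ∀ z ∈ V, wedge (v z) (w z) ≠ 0)
    (hwu : ∀ z ∈ V, wedge (w z) (u z) ≠ 0) (x : ℂ × ℂ) :
    AnalyticOnNhd ℂ (symbolForm u v w x) V := by
  refine analyticOnNhd_clm hV fun y z hz => ?_
  have hb : ∀ {f : ℂ × ℂ → ℂ × ℂ}, AnalyticAt ℂ f z →
      AnalyticAt ℂ (fun z => wedge (f z) (fderiv ℂ f z y)) z := fun hf =>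
    analyticAt_wedge hf (analyticAt_clm_apply hf.fderiv analyticAt_const)
  simp only [symbolForm, add_apply, smul_apply, ContinuousLinearMap.comp_apply, wedgeForm_apply,
    smul_eq_mul]
  exact (((analyticAt_lagrange (hu z hz) (hv z hz) (hw z hz) (huv z hz)
      (wedge_ne_zero_symm (hwu z hz)) x).mul (hb (hu z hz))).add
    ((analyticAt_lagrange (hv z hz) (hw z hz) (hu z hz) (hvw z hz)
      (wedge_ne_zero_symm (huv z hz)) x).mul (hb (hv z hz)))).add
    ((analyticAt_lagrange (hw z hz) (hu z hz) (hv z hz) (hwu z hz)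
      (wedge_ne_zero_symm (hvw z hz)) x).mul (hb (hw z hz)))

/-- det(u, [X, u]) = 0 turns det(u, DX u) into det(u, Du X), which involves only the value of X;
likewise for v and w, and interpolation does the rest. -/
theorem wedge_fderiv_eq_symbolForm {u v w X : ℂ × ℂ → ℂ × ℂ} {z : ℂ × ℂ}
    (huv : wedge (u z) (v z) ≠ 0) (hvw : wedge (v z) (w z) ≠ 0) (hwu : wedge (w z) (u z) ≠ 0)
    (hXu : wedge (u z) (lieBracket ℂ X u z) = 0) (hXv : wedge (v z) (lieBracket ℂ X v z) = 0)
    (hXw : wedge (w z) (lieBracket ℂ X w z) = 0) (x : ℂ × ℂ) :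
    wedge x (fderiv ℂ X z x) = symbolForm u v w x z (X z) := by
  have hb : ∀ {f : ℂ × ℂ → ℂ × ℂ}, wedge (f z) (lieBracket ℂ X f z) = 0 →
      wedge (f z) (fderiv ℂ X z (f z)) = wedge (f z) (fderiv ℂ f z (X z)) := fun h => by
    simp only [lieBracket, wedge, Prod.fst_sub, Prod.snd_sub] at h ⊢
    linear_combination -h
  rw [lagrange_interpolation (fderiv ℂ X z) huv hvw hwu x, hb hXu, hb hXv, hb hXw]
  simp [symbolForm]

/-- The connection on `ℂ³` whose flat sections are the symmetries of a `3`-web. -/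
def webConnection (u v w : ℂ × ℂ → ℂ × ℂ) :
    ℂ × ℂ → ((ℂ × ℂ) × ℂ) →L[ℂ] (ℂ × ℂ →L[ℂ] (ℂ × ℂ) × ℂ) :=
  prolong (fun z => -symbolForm u v w (0, 1) z) (symbolForm u v w (1, 0))
    (fun z => symbolForm u v w (1, 1) z - symbolForm u v w (1, 0) z - symbolForm u v w (0, 1) z)

theorem analyticOnNhd_webConnection {u v w : ℂ × ℂ → ℂ × ℂ} {V : Set (ℂ × ℂ)} (hV : IsOpen V)
    (hu : AnalyticOnNhd ℂ u V) (hv : AnalyticOnNhd ℂ v V) (hw : AnalyticOnNhd ℂ w V)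
    (huv : ∀ z ∈ V, wedge (u z) (v z) ≠ 0) (hvw : ∀ z ∈ V, wedge (v z) (w z) ≠ 0)
    (hwu : ∀ z ∈ V, wedge (w z) (u z) ≠ 0) : AnalyticOnNhd ℂ (webConnection u v w) V := by
  have h := analyticOnNhd_symbolForm hV hu hv hw huv hvw hwu
  exact analyticOnNhd_prolong hV (h _).neg (h _) (((h _).sub (h _)).sub (h _))

/-- The `1`-jet `(X, ∂ₓX₁)` of a vector field. -/
def jet (X : ℂ × ℂ → ℂ × ℂ) (z : ℂ × ℂ) : (ℂ × ℂ) × ℂ := (X z, (fderiv ℂ X z (1, 0)).1)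

theorem analyticAt_jet {X : ℂ × ℂ → ℂ × ℂ} {z : ℂ × ℂ} (hX : AnalyticAt ℂ X z) :
    AnalyticAt ℂ (jet X) z :=
  hX.prod (analyticAt_fst.comp (analyticAt_clm_apply hX.fderiv analyticAt_const))

/-- The quadratic form at (1, 0) and (0, 1) gives ∂ₓX₂ and -∂ᵧX₁, and its polarization gives ∂ᵧX₂ -
∂ₓX₁: precisely the system that `prolong` completes. -/
theorem fderiv_jet {u v w X : ℂ × ℂ → ℂ × ℂ} {V : Set (ℂ × ℂ)} (hV : IsOpen V)
    (hu : AnalyticOnNhd ℂ u V) (hv : AnalyticOnNhd ℂ v V) (hw : AnalyticOnNhd ℂ w V)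
    (huv : ∀ z ∈ V, wedge (u z) (v z) ≠ 0) (hvw : ∀ z ∈ V, wedge (v z) (w z) ≠ 0)
    (hwu : ∀ z ∈ V, wedge (w z) (u z) ≠ 0) {q : ℂ × ℂ} (hq : q ∈ V) (hX : AnalyticAt ℂ X q)
    (hXs : ∀ᶠ z in 𝓝 q, wedge (u z) (lieBracket ℂ X u z) = 0 ∧
      wedge (v z) (lieBracket ℂ X v z) = 0 ∧ wedge (w z) (lieBracket ℂ X w z) = 0) :
    fderiv ℂ (jet X) q = webConnection u v w q (jet X q) := by
  have h := analyticOnNhd_symbolForm hV hu hv hw huv hvw hwu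
  have hs : ∀ᶠ z in 𝓝 q, ∀ x, wedge x (fderiv ℂ X z x) = symbolForm u v w x z (X z) := by
    filter_upwards [hXs, hV.mem_nhds hq] with z hz hzV x
    exact wedge_fderiv_eq_symbolForm (huv z hzV) (hvw z hzV) (hwu z hzV) hz.1 hz.2.1 hz.2.2 x
  have h₁ : ∀ᶠ z in 𝓝 q, (fderiv ℂ X z (0, 1)).1 = -symbolForm u v w (0, 1) z (X z) := by
    filter_upwards [hs] with z hz
    rw [← hz]
    simp [wedge]
  have h₂ : ∀ᶠ z in 𝓝 q, (fderiv ℂ X z (1, 0)).2 = symbolForm u v w (1, 0) z (X z) := by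
    filter_upwards [hs] with z hz
    rw [← hz]
    simp [wedge]
  refine fderiv_prolong (h _ q hq).neg (h _ q hq)
    (((h _ q hq).sub (h _ q hq)).sub (h _ q hq)) hX ?_ h₂ ?_
  · filter_upwards [h₁] with z hz
    rw [hz]
    simp
  · filter_upwards [hs, h₁, h₂] with z hz hz₁ hz₂
    have e : ((1 : ℂ), (1 : ℂ)) = (1, 0) + (0, 1) := by ext <;> simp
    have h₃ := hz (1, 1)
    simp only [wedge, one_mul] at h₃
    have e' : fderiv ℂ X z (1, 1) = fderiv ℂ X z (1, 0) + fderiv ℂ X z (0, 1) := by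
      rw [e, map_add]
    rw [e', Prod.fst_add, Prod.snd_add] at h₃
    simp only [sub_apply]
    linear_combination h₃ + hz₁ - hz₂

end Connection

/-! ### Local bases of symmetries. -/

noncomputable section LocalBasis

open VectorField

variable {U : Opens (ℂ × ℂ)}

/-- The vector fields on `ℂ²` which are symmetries at every point of `B`. -/
def symOn (F : Polynomial (Holo U)) (B : Set (ℂ × ℂ)) : Submodule ℂ (ℂ × ℂ → ℂ × ℂ) where
  carrier := {X | ∀ q ∈ B, IsSymmetryAt F X q}
  zero_mem' := fun q _ => IsSymmetryAt.zero F q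
  add_mem' := fun hX hY q hq => (hX q hq).add (hY q hq)
  smul_mem' := fun c _ hX q hq => (hX q hq).smul c

/-- The `1`-jet at `q` of the symmetries on `B`. -/
def jetMap (F : Polynomial (Holo U)) (B : Set (ℂ × ℂ)) {q : ℂ × ℂ} (hq : q ∈ B) :
    symOn F B →ₗ[ℂ] (ℂ × ℂ) × ℂ where
  toFun X := jet X.1 q
  map_add' X Y := by
    have hX := (X.2 q hq).1.differentiableAt
    have hY := (Y.2 q hq).1.differentiableAt
    simp [jet, fderiv_add hX hY]
  map_smul' c X := by
    have hX := (X.2 q hq).1.differentiableAt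
    simp [jet, fderiv_const_smul hX c]

/-- `Y` is a basis over `ℂ` of the germs of symmetries at each point of `B`. -/
structure IsLocalBasis (F : Polynomial (Holo U)) (B : Set (ℂ × ℂ)) {r : ℕ}
    (Y : Fin r → ℂ × ℂ → ℂ × ℂ) : Prop where
  mem : ∀ i, Y i ∈ symOn F B
  existsUnique : ∀ q ∈ B, ∀ X, (∀ᶠ z in 𝓝 q, IsSymmetryAt F X z) →
    ∃! c : Fin r → ℂ, X =ᶠ[𝓝 q] fun z => ∑ i, c i • Y i z

theorem analyticAt_lieBracket {X w : ℂ × ℂ → ℂ × ℂ} {z : ℂ × ℂ} (hX : AnalyticAt ℂ X z)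
    (hw : AnalyticAt ℂ w z) : AnalyticAt ℂ (lieBracket ℂ X w) z :=
  (analyticAt_clm_apply hw.fderiv hX).sub (analyticAt_clm_apply hX.fderiv hw)

/-- The web of `F` has the frame `w` on the whole ball. -/
theorem exists_ball_frame (F : Polynomial (Holo U)) (hd : 2 ≤ F.natDegree) {q₀ : ℂ × ℂ}
    (hq₀ : q₀ ∈ regularLocus F) :
    ∃ w : Fin F.natDegree → ℂ × ℂ → ℂ × ℂ, ∃ ρ > 0, ∀ q ∈ Metric.ball q₀ ρ, IsFrameAt F w q := by
  obtain ⟨w, hw, hw'⟩ := exists_web_frame F hd hq₀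
  have : IsFrameAt F w q₀ := by
    refine ⟨hw, ?_⟩
    filter_upwards [hw', U.isOpen.mem_nhds hq₀.1] with q h1 h2
    exact ⟨h2, h1⟩
  obtain ⟨ρ, hρ, h⟩ := Metric.eventually_nhds_iff_ball.1 this.eventually
  exact ⟨w, ρ, hρ, h⟩

/-- A holomorphic vector field on a ball which is a symmetry near one point is a symmetry. -/
theorem mem_symOn_of_eventually {F : Polynomial (Holo U)} {ι : Type} [Finite ι] [Nontrivial ι]
    {w : ι → ℂ × ℂ → ℂ × ℂ} {B : Set (ℂ × ℂ)} (hB : IsPreconnected B)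
    (hw : ∀ q ∈ B, IsFrameAt F w q) {X : ℂ × ℂ → ℂ × ℂ} (hX : AnalyticOnNhd ℂ X B)
    {q : ℂ × ℂ} (hq : q ∈ B) (hs : ∀ᶠ z in 𝓝 q, IsSymmetryAt F X z) : X ∈ symOn F B := by
  intro z hz
  refine (isSymmetryAt_iff (hw z hz) X).2 ⟨hX z hz, fun i => ?_⟩
  have han : AnalyticOnNhd ℂ (fun z => wedge (w i z) (lieBracket ℂ X (w i) z)) B := fun z hz =>
    analyticAt_wedge ((hw z hz).1 i) (analyticAt_lieBracket (hX z hz) ((hw z hz).1 i))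
  refine han.eqOn_zero_of_preconnected_of_eventuallyEq_zero hB hq ?_ hz
  filter_upwards [hs, (hw q hq).eventually] with y hy hy'
  exact ((isSymmetryAt_iff hy' X).1 hy).2 i

/-- On a small ball, every germ of symmetry extends, and a symmetry is determined by its jet at
the centre. -/
theorem exists_ball_extension (F : Polynomial (Holo U)) (hd : 3 ≤ F.natDegree) {q₀ : ℂ × ℂ}
    (hq₀ : q₀ ∈ regularLocus F) :
    ∃ ρ > 0, (∀ q ∈ Metric.ball q₀ ρ, ∀ X, (∀ᶠ z in 𝓝 q, IsSymmetryAt F X z) →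
        ∃ Y ∈ symOn F (Metric.ball q₀ ρ), Y =ᶠ[𝓝 q] X) ∧
      ∀ X ∈ symOn F (Metric.ball q₀ ρ), jet X q₀ = 0 → X =ᶠ[𝓝 q₀] 0 := by
  obtain ⟨w, ρ₁, hρ₁, hw⟩ := exists_ball_frame F (by omega) hq₀
  set V := Metric.ball q₀ ρ₁ with hV
  have hVo : IsOpen V := Metric.isOpen_ball
  have : Nontrivial (Fin F.natDegree) := Fin.nontrivial_iff_two_le.2 (by omega)
  set i₀ : Fin F.natDegree := ⟨0, by omega⟩
  set i₁ : Fin F.natDegree := ⟨1, by omega⟩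
  set i₂ : Fin F.natDegree := ⟨2, by omega⟩
  have han : ∀ i, AnalyticOnNhd ℂ (w i) V := fun i z hz => (hw z hz).1 i
  have hne : ∀ i j, i ≠ j → ∀ z ∈ V, wedge (w i z) (w j z) ≠ 0 := fun i j hij z hz =>
    (hw z hz).2.self_of_nhds.2.1 i j hij
  have h01 : i₀ ≠ i₁ := by simp [i₀, i₁]
  have h12 : i₁ ≠ i₂ := by simp [i₁, i₂]
  have h20 : i₂ ≠ i₀ := by simp [i₂, i₀]
  have hM := analyticOnNhd_webConnection hVo (han i₀) (han i₁) (han i₂) (hne _ _ h01)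
    (hne _ _ h12) (hne _ _ h20)
  set M := webConnection (w i₀) (w i₁) (w i₂) with hMdef
  have hq₀V : q₀ ∈ V := Metric.mem_ball_self hρ₁
  have hflat : ∀ q ∈ V, ∀ X, (∀ᶠ z in 𝓝 q, IsSymmetryAt F X z) →
      ∀ᶠ z in 𝓝 q, fderiv ℂ (jet X) z = M z (jet X z) := by
    intro q hq X hX
    filter_upwards [hX.eventually_nhds, hVo.mem_nhds hq] with z hz hzV
    refine fderiv_jet hVo (han i₀) (han i₁) (han i₂) (hne _ _ h01)
      (hne _ _ h12) (hne _ _ h20) hzV hz.self_of_nhds.1 ?_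
    filter_upwards [hz, hVo.mem_nhds hzV] with y hy hyV
    have := ((isSymmetryAt_iff (hw y hyV) X).1 hy).2
    exact ⟨this i₀, this i₁, this i₂⟩
  obtain ⟨ρ₂, hρ₂, hext⟩ := exists_ball_flat_extension (hM q₀ hq₀V)
  refine ⟨min ρ₁ ρ₂, by positivity, ?_, ?_⟩
  · intro q hq X hX
    have hqV : q ∈ V := Metric.ball_subset_ball (min_le_left _ _) hq
    obtain ⟨S, hS, hSX, -⟩ := hext q (Metric.ball_subset_ball (min_le_right _ _) hq) (jet X)
      (analyticAt_jet hX.self_of_nhds.1) (hflat q hqV X hX)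
    have heq : (fun z => (S z).1) =ᶠ[𝓝 q] X := hSX.mono fun z hz => by simp only [hz, jet]
    refine ⟨fun z => (S z).1, ?_, heq⟩
    -- The connection only knows three of the d directions; analytic continuation from q shows that
    -- the extension respects them all.
    refine mem_symOn_of_eventually (convex_ball q₀ _).isPreconnected
      (fun z hz => hw z (Metric.ball_subset_ball (min_le_left _ _) hz))
      (fun z hz => analyticAt_fst.comp (hS z (Metric.ball_subset_ball (min_le_right _ _) hz)))
      hq ?_
    filter_upwards [hX, heq.eventuallyEq_nhds] with z hz hz'
    exact hz.congr hz'.symm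
  · intro X hX h0
    have hq₀B : q₀ ∈ Metric.ball q₀ (min ρ₁ ρ₂) := Metric.mem_ball_self (by positivity)
    have hX' : ∀ᶠ z in 𝓝 q₀, IsSymmetryAt F X z :=
      Filter.mem_of_superset (Metric.isOpen_ball.mem_nhds hq₀B) hX
    have := eventuallyEq_zero_of_flat (hM q₀ hq₀V) (analyticAt_jet (hX q₀ hq₀B).1)
      (hflat q₀ hq₀V X hX') h0
    exact this.mono fun z hz => congrArg Prod.fst hz

/-- The symmetries form a local system of rank at most `3` near each regular point. -/
theorem exists_isLocalBasis (F : Polynomial (Holo U)) (hd : 3 ≤ F.natDegree) {q₀ : ℂ × ℂ}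
    (hq₀ : q₀ ∈ regularLocus F) :
    ∃ B : Set (ℂ × ℂ), IsOpen B ∧ q₀ ∈ B ∧ ∃ r ≤ 3, ∃ Y : Fin r → ℂ × ℂ → ℂ × ℂ,
      IsLocalBasis F B Y := by
  obtain ⟨ρ, hρ, hext, hinj⟩ := exists_ball_extension F hd hq₀
  set B := Metric.ball q₀ ρ with hB
  have hq₀B : q₀ ∈ B := Metric.mem_ball_self hρ
  have hBc : IsPreconnected B := (convex_ball q₀ ρ).isPreconnected
  have hanB : ∀ X ∈ symOn F B, AnalyticOnNhd ℂ X B := fun X hX z hz => (hX z hz).1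
  set L := jetMap F B hq₀B with hL
  have hzero : ∀ X ∈ symOn F B, jet X q₀ = 0 → ∀ q ∈ B, X =ᶠ[𝓝 q] 0 := by
    intro X hX h0 q hq
    have h1 := (hanB X hX).eqOn_zero_of_preconnected_of_eventuallyEq_zero hBc hq₀B (hinj X hX h0)
    exact Filter.mem_of_superset (Metric.isOpen_ball.mem_nhds hq) h1
  -- Members of `symOn` are arbitrary off B, so a basis of their jets in ℂ³ is lifted rather than a
  -- basis of `symOn` chosen.
  set b := Module.finBasis ℂ (LinearMap.range L) with hb
  have hlift : ∀ i, ∃ X : symOn F B, L X = b i := fun i => (b i).2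
  choose Y hY using hlift
  have hsum : ∀ c : Fin (Module.finrank ℂ (LinearMap.range L)) → ℂ,
      (∑ i, c i • Y i : symOn F B).1 = fun z => ∑ i, c i • (Y i).1 z := fun c => by
    ext1 z
    simp [Finset.sum_apply]
  have hLsum : ∀ c : Fin (Module.finrank ℂ (LinearMap.range L)) → ℂ,
      L (∑ i, c i • Y i) = (∑ i, c i • b i : LinearMap.range L).1 := fun c => by
    simp [hY]
  refine ⟨B, Metric.isOpen_ball, hq₀B, Module.finrank ℂ (LinearMap.range L), ?_,
    fun i => (Y i).1, fun i => (Y i).2, ?_⟩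
  · refine (Submodule.finrank_le _).trans ?_
    simp
  · intro q hq X hX
    obtain ⟨X', hX', hXX'⟩ := hext q hq X hX
    set c := b.repr ⟨L ⟨X', hX'⟩, LinearMap.mem_range_self _ _⟩ with hc
    refine ⟨c, ?_, ?_⟩
    · set D : symOn F B := ⟨X', hX'⟩ - ∑ i, c i • Y i with hD
      have h1 : L D = 0 := by
        rw [hD, map_sub, hLsum, hc, b.sum_repr, sub_self]
      have h2 := hzero D.1 D.2 h1 q hq
      filter_upwards [h2, hXX'] with z hz hz'
      have h3 := congrFun (hsum c) z
      rw [← hz', ← h3, ← sub_eq_zero]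
      exact hz
    · intro c' hc'
      have h1 : (∑ i, c' i • Y i : symOn F B).1 =ᶠ[𝓝 q] X' := by
        rw [hsum]
        exact hc'.symm.trans hXX'.symm
      have h2 := (hanB _ (∑ i, c' i • Y i : symOn F B).2).eqOn_of_preconnected_of_eventuallyEq
        (hanB X' hX') hBc hq h1
      have h3 : (∑ i, c' i • Y i : symOn F B).1 =ᶠ[𝓝 q₀] X' :=
        Filter.mem_of_superset (Metric.isOpen_ball.mem_nhds hq₀B) h2
      have h4 : L (∑ i, c' i • Y i) = L ⟨X', hX'⟩ := by
        change jet _ q₀ = jet _ q₀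
        simp only [jet, h3.fderiv_eq, h3.eq_of_nhds]
      rw [hLsum] at h4
      have h5 : (∑ i, c' i • b i) = ⟨L ⟨X', hX'⟩, LinearMap.mem_range_self _ _⟩ := Subtype.ext h4
      rw [hc, ← h5, b.repr_sum_self]

end LocalBasis

/-! ### Exclusion of rank two. -/

noncomputable section RankTwo

open VectorField

variable {U : Opens (ℂ × ℂ)}

theorem exists_analytic_quotient {V W : ℂ × ℂ → ℂ × ℂ} {q : ℂ × ℂ} (hV : AnalyticAt ℂ V q)
    (hW : AnalyticAt ℂ W q) (h0 : W q ≠ 0) (hp : ∀ᶠ z in 𝓝 q, wedge (W z) (V z) = 0) :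
    ∃ f : ℂ × ℂ → ℂ, AnalyticAt ℂ f q ∧ V =ᶠ[𝓝 q] fun z => f z • W z := by
  by_cases h1 : (W q).1 = 0
  · have h2 : (W q).2 ≠ 0 := fun h => h0 (Prod.ext h1 h)
    have hW2 : AnalyticAt ℂ (fun z => (W z).2) q := analyticAt_snd.comp hW
    refine ⟨fun z => (V z).2 / (W z).2, (analyticAt_snd.comp hV).div hW2 h2, ?_⟩
    filter_upwards [hp, hW2.continuousAt.eventually_ne h2] with z hz hz2
    simp only [wedge] at hz
    refine Prod.ext ?_ (by simp [hz2])
    simp only [Prod.smul_fst, smul_eq_mul]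
    field_simp
    linear_combination -hz
  · have hW1 : AnalyticAt ℂ (fun z => (W z).1) q := analyticAt_fst.comp hW
    refine ⟨fun z => (V z).1 / (W z).1, (analyticAt_fst.comp hV).div hW1 h1, ?_⟩
    filter_upwards [hp, hW1.continuousAt.eventually_ne h1] with z hz hz1
    simp only [wedge] at hz
    refine Prod.ext (by simp [hz1]) ?_
    simp only [Prod.smul_snd, smul_eq_mul]
    field_simp
    linear_combination hz

/-- With [X, w] = f w and [Y, w] = g w, the Jacobi identity makes [[X, Y], w] a multiple of w. -/
theorem wedge_lieBracket_lieBracket {X Y w : ℂ × ℂ → ℂ × ℂ} {q : ℂ × ℂ}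
    (hX : AnalyticAt ℂ X q) (hY : AnalyticAt ℂ Y q) (hw : AnalyticAt ℂ w q) (hw0 : w q ≠ 0)
    (hXw : ∀ᶠ z in 𝓝 q, wedge (w z) (lieBracket ℂ X w z) = 0)
    (hYw : ∀ᶠ z in 𝓝 q, wedge (w z) (lieBracket ℂ Y w z) = 0) :
    wedge (w q) (lieBracket ℂ (lieBracket ℂ X Y) w q) = 0 := by
  obtain ⟨f, hf, hfX⟩ := exists_analytic_quotient (analyticAt_lieBracket hX hw) hw hw0 hXw
  obtain ⟨g, hg, hgY⟩ := exists_analytic_quotient (analyticAt_lieBracket hY hw) hw hw0 hYw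
  have hJ := leibniz_identity_lieBracket (𝕜 := ℂ) (n := ⊤) le_top hX.contDiffAt hY.contDiffAt
    hw.contDiffAt
  have e1 : lieBracket ℂ X (lieBracket ℂ Y w) q = lieBracket ℂ X (fun z => g z • w z) q :=
    Filter.EventuallyEq.lieBracket_vectorField_eq Filter.EventuallyEq.rfl hgY
  have e2 : lieBracket ℂ Y (lieBracket ℂ X w) q = lieBracket ℂ Y (fun z => f z • w z) q :=
    Filter.EventuallyEq.lieBracket_vectorField_eq Filter.EventuallyEq.rfl hfX
  rw [e1, e2, lieBracket_smul_right hg.differentiableAt hw.differentiableAt,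
    lieBracket_smul_right hf.differentiableAt hw.differentiableAt, hfX.eq_of_nhds,
    hgY.eq_of_nhds] at hJ
  have h3 := congrArg (wedge (w q)) hJ
  simp only [wedge_add_right, wedge_smul_right, wedge_self, mul_zero, add_zero] at h3
  exact h3.symm

/-- The bracket of two symmetries is a symmetry. -/
theorem IsSymmetryAt.lieBracket {F : Polynomial (Holo U)} {ι : Type} [Finite ι] [Nontrivial ι]
    {w : ι → ℂ × ℂ → ℂ × ℂ} {q : ℂ × ℂ} (hw : IsFrameAt F w q) {X Y : ℂ × ℂ → ℂ × ℂ}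
    (hX : ∀ᶠ z in 𝓝 q, IsSymmetryAt F X z) (hY : ∀ᶠ z in 𝓝 q, IsSymmetryAt F Y z) :
    IsSymmetryAt F (lieBracket ℂ X Y) q := by
  have hXa := hX.self_of_nhds.1
  have hYa := hY.self_of_nhds.1
  refine (isSymmetryAt_iff hw _).2 ⟨analyticAt_lieBracket hXa hYa, fun i => ?_⟩
  refine wedge_lieBracket_lieBracket hXa hYa (hw.1 i) (hw.ne_zero i) ?_ ?_
  · filter_upwards [hX, hw.eventually] with z hz hwz
    exact ((isSymmetryAt_iff hwz X).1 hz).2 i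
  · filter_upwards [hY, hw.eventually] with z hz hwz
    exact ((isSymmetryAt_iff hwz Y).1 hz).2 i

theorem wedge_smul_add_eq (X Y v : ℂ × ℂ) :
    wedge X Y • v = wedge v Y • X + wedge X v • Y := by
  ext <;> simp only [wedge, Prod.smul_fst, Prod.smul_snd, Prod.fst_add, Prod.snd_add,
    smul_eq_mul] <;> ring

theorem exists_coords {X Y : ℂ × ℂ} (h : wedge X Y ≠ 0) (v : ℂ × ℂ) :
    ∃ s t : ℂ, v = s • X + t • Y := by
  refine ⟨wedge v Y / wedge X Y, wedge X v / wedge X Y, ?_⟩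
  have := wedge_smul_add_eq X Y v
  rw [← smul_right_inj h, this, smul_add, smul_smul, smul_smul, mul_div_cancel₀ _ h,
    mul_div_cancel₀ _ h]

/-- Prescribing the derivatives of a function along a frame with constant structure
coefficients. -/
theorem exists_primitive_of_frame {X Y : ℂ × ℂ → ℂ × ℂ} {q : ℂ × ℂ} {a b : ℂ}
    (hX : AnalyticAt ℂ X q) (hY : AnalyticAt ℂ Y q) (h0 : wedge (X q) (Y q) ≠ 0)
    (hXY : ∀ᶠ z in 𝓝 q, lieBracket ℂ X Y z = a • X z + b • Y z) {g h : ℂ × ℂ → ℂ}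
    (hg : AnalyticAt ℂ g q) (hh : AnalyticAt ℂ h q)
    (hint : ∀ᶠ z in 𝓝 q, fderiv ℂ h z (X z) - fderiv ℂ g z (Y z) = a * g z + b * h z) :
    ∃ u : ℂ × ℂ → ℂ, AnalyticAt ℂ u q ∧
      ∀ᶠ z in 𝓝 q, fderiv ℂ u z (X z) = g z ∧ fderiv ℂ u z (Y z) = h z := by
  set W : ℂ × ℂ → ℂ := fun z => wedge (X z) (Y z) with hW
  have hWa : AnalyticAt ℂ W q := analyticAt_wedge hX hY
  -- The form with η(X) = g and η(Y) = h. It is closed because dη(X, Y) = X h - Y g - η([X, Y]),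
  -- which `hint` makes zero.
  set η : ℂ × ℂ → (ℂ × ℂ →L[ℂ] ℂ) := fun z =>
    (h z / W z) • wedgeForm (X z) - (g z / W z) • wedgeForm (Y z) with hη
  have hηa : AnalyticAt ℂ η q := ((hh.div hWa h0).smul (analyticAt_wedgeForm hX)).sub
    ((hg.div hWa h0).smul (analyticAt_wedgeForm hY))
  have hne : ∀ᶠ z in 𝓝 q, W z ≠ 0 := hWa.continuousAt.eventually_ne h0
  have hηX : ∀ᶠ z in 𝓝 q, η z (X z) = g z := by
    filter_upwards [hne] with z hz
    simp only [hη, sub_apply, smul_apply, wedgeForm_apply, wedge_self, smul_eq_mul, mul_zero]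
    rw [wedge_swap (Y z), mul_neg, zero_sub, neg_neg, div_mul_cancel₀ _ hz]
  have hηY : ∀ᶠ z in 𝓝 q, η z (Y z) = h z := by
    filter_upwards [hne] with z hz
    simp only [hη, sub_apply, smul_apply, wedgeForm_apply, wedge_self, smul_eq_mul, mul_zero]
    rw [sub_zero, div_mul_cancel₀ _ hz]
  obtain ⟨u, hu, hdu⟩ := exists_analyticAt_primitive hηa (by
    filter_upwards [hne, hηX.eventually_nhds, hηY.eventually_nhds, hXY, hint,
      hηa.eventually_analyticAt, hX.eventually_analyticAt, hY.eventually_analyticAt]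
      with z hz hzX hzY hzXY hzint hza hXz hYz
    have e1 : fderiv ℂ (fun z => η z (X z)) z = fderiv ℂ g z :=
      Filter.EventuallyEq.fderiv_eq hzX
    have e2 : fderiv ℂ (fun z => η z (Y z)) z = fderiv ℂ h z :=
      Filter.EventuallyEq.fderiv_eq hzY
    rw [fderiv_clm_apply hza.differentiableAt hXz.differentiableAt] at e1
    rw [fderiv_clm_apply hza.differentiableAt hYz.differentiableAt] at e2
    have e3 := congrArg (fun f => f (Y z)) e1
    have e4 := congrArg (fun f => f (X z)) e2
    have e5 := congrArg (η z) hzXY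
    simp only [add_apply, ContinuousLinearMap.comp_apply, ContinuousLinearMap.flip_apply] at e3 e4
    rw [lieBracket, map_sub, map_add, map_smul, map_smul, hzX.self_of_nhds,
      hzY.self_of_nhds, smul_eq_mul, smul_eq_mul] at e5
    have key : fderiv ℂ η z (X z) (Y z) = fderiv ℂ η z (Y z) (X z) := by
      linear_combination e4 - e3 - e5 + hzint
    intro v v'
    obtain ⟨s, t, rfl⟩ := exists_coords hz v
    obtain ⟨s', t', rfl⟩ := exists_coords hz v'
    simp only [map_add, map_smul, add_apply, smul_apply, smul_eq_mul]
    linear_combination (s * t' - t * s') * key)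
  refine ⟨u, hu, ?_⟩
  filter_upwards [hdu, hηX, hηY] with z hz hzX hzY
  rw [hz.fderiv, hzX, hzY]
  exact ⟨rfl, rfl⟩

/-- [uX + vY, w] = u[X, w] + v[Y, w] - (w u)X - (w v)Y, and the last two terms add up to -c w,
whatever the coordinates of w in the frame X, Y. -/
theorem wedge_lieBracket_dilation {X Y w : ℂ × ℂ → ℂ × ℂ} {u v : ℂ × ℂ → ℂ} {z : ℂ × ℂ} {c : ℂ}
    (hX : DifferentiableAt ℂ X z) (hY : DifferentiableAt ℂ Y z)
    (hu : DifferentiableAt ℂ u z) (hv : DifferentiableAt ℂ v z) (h0 : wedge (X z) (Y z) ≠ 0)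
    (huX : fderiv ℂ u z (X z) = c) (huY : fderiv ℂ u z (Y z) = 0)
    (hvX : fderiv ℂ v z (X z) = 0) (hvY : fderiv ℂ v z (Y z) = c)
    (hXw : wedge (w z) (lieBracket ℂ X w z) = 0) (hYw : wedge (w z) (lieBracket ℂ Y w z) = 0) :
    wedge (w z) (lieBracket ℂ (fun z => u z • X z + v z • Y z) w z) = 0 := by
  have e : (fun z => u z • X z + v z • Y z) = (fun z => u z • X z) + fun z => v z • Y z := rfl
  rw [e, lieBracket_add_left (hu.fun_smul hX) (hv.fun_smul hY), lieBracket_smul_left hu hX,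
    lieBracket_smul_left hv hY]
  obtain ⟨s, t, hst⟩ := exists_coords h0 (w z)
  have h1 : fderiv ℂ u z (w z) = s * c := by
    rw [hst]; simp [huX, huY]
  have h2 : fderiv ℂ v z (w z) = t * c := by
    rw [hst]; simp [hvX, hvY]
  have h3 := wedge_self (w z)
  nth_rewrite 2 [hst] at h3
  simp only [wedge_add_right, wedge_smul_right] at h3 ⊢
  simp only [h1, h2, hXw, hYw]
  linear_combination -c * h3

/-- A web with two independent transitive symmetries spanning a Lie algebra of dimension two has a
further symmetry. -/
theorem not_transitive_rank_two {F : Polynomial (Holo U)} {ι : Type} [Finite ι] [Nontrivial ι]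
    {w : ι → ℂ × ℂ → ℂ × ℂ} {B : Set (ℂ × ℂ)} (hB : IsOpen B) {Y : Fin 2 → ℂ × ℂ → ℂ × ℂ}
    (hY : IsLocalBasis F B Y) {q : ℂ × ℂ} (hq : q ∈ B) (hw : IsFrameAt F w q)
    (h0 : wedge (Y 0 q) (Y 1 q) ≠ 0) : False := by
  have hev : ∀ i, ∀ᶠ z in 𝓝 q, IsSymmetryAt F (Y i) z := fun i =>
    Filter.mem_of_superset (hB.mem_nhds hq) (hY.mem i)
  have han : ∀ i, AnalyticAt ℂ (Y i) q := fun i => (hev i).self_of_nhds.1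
  have hbr : ∀ᶠ z in 𝓝 q, IsSymmetryAt F (lieBracket ℂ (Y 0) (Y 1)) z := by
    filter_upwards [(hev 0).eventually_nhds, (hev 1).eventually_nhds, hw.eventually]
      with z h1 h2 h3
    exact IsSymmetryAt.lieBracket h3 h1 h2
  obtain ⟨c, hc, -⟩ := hY.existsUnique q hq _ hbr
  have hXY : ∀ᶠ z in 𝓝 q, lieBracket ℂ (Y 0) (Y 1) z = c 0 • Y 0 z + c 1 • Y 1 z := by
    filter_upwards [hc] with z hz
    rw [hz, Fin.sum_univ_two]
  -- The integrating factor e = exp f satisfies Y₀e = c₁e and Y₁e = -c₀e, exactly the integrability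
  -- conditions of the systems for u and v.
  obtain ⟨f, hf, hdf⟩ := exists_primitive_of_frame (han 0) (han 1) h0 hXY
    (g := fun _ => c 1) (h := fun _ => -c 0) analyticAt_const analyticAt_const
    (Filter.Eventually.of_forall fun z => by simp; ring)
  set e : ℂ × ℂ → ℂ := fun z => Complex.exp (f z) with he
  have hea : AnalyticAt ℂ e q := hf.cexp
  have hde : ∀ᶠ z in 𝓝 q, fderiv ℂ e z (Y 0 z) = e z * c 1 ∧
      fderiv ℂ e z (Y 1 z) = -(e z * c 0) := by
    filter_upwards [hdf, hf.eventually_analyticAt] with z hz hza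
    rw [hza.differentiableAt.hasFDerivAt.cexp.fderiv]
    simp [hz.1, hz.2, he]
  obtain ⟨u, hu, hdu⟩ := exists_primitive_of_frame (han 0) (han 1) h0 hXY
    (g := e) (h := fun _ => 0) hea analyticAt_const (by
      filter_upwards [hde] with z hz
      simp [hz.2]; ring)
  obtain ⟨v, hv, hdv⟩ := exists_primitive_of_frame (han 0) (han 1) h0 hXY
    (g := fun _ => 0) (h := e) analyticAt_const hea (by
      filter_upwards [hde] with z hz
      simp [hz.1]; ring)
  have hne : ∀ᶠ z in 𝓝 q, wedge (Y 0 z) (Y 1 z) ≠ 0 :=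
    (analyticAt_wedge (han 0) (han 1)).continuousAt.eventually_ne h0
  have hE : ∀ᶠ z in 𝓝 q, IsSymmetryAt F (fun z => u z • Y 0 z + v z • Y 1 z) z := by
    filter_upwards [hev 0, hev 1, hw.eventually, hdu, hdv, hu.eventually_analyticAt,
      hv.eventually_analyticAt, hne] with z h1 h2 h3 h4 h5 h6 h7 h8
    refine (isSymmetryAt_iff h3 _).2 ⟨(h6.smul h1.1).add (h7.smul h2.1), fun i => ?_⟩
    exact wedge_lieBracket_dilation h1.1.differentiableAt h2.1.differentiableAt
      h6.differentiableAt h7.differentiableAt h8 h4.1 h4.2 h5.1 h5.2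
      (((isSymmetryAt_iff h3 _).1 h1).2 i) (((isSymmetryAt_iff h3 _).1 h2).2 i)
  -- If the new symmetry were a constant combination of Y₀ and Y₁, then u would be constant, against
  -- Y₀u = e ≠ 0.
  obtain ⟨k, hk, -⟩ := hY.existsUnique q hq _ hE
  have huk : u =ᶠ[𝓝 q] fun _ => k 0 := by
    filter_upwards [hk, hne] with z hz hz0
    rw [Fin.sum_univ_two] at hz
    have h1 := congrArg Prod.fst hz
    have h2 := congrArg Prod.snd hz
    simp only [Prod.fst_add, Prod.snd_add, Prod.smul_fst, Prod.smul_snd, smul_eq_mul] at h1 h2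
    refine (mul_left_inj' hz0).1 ?_
    simp only [wedge]
    linear_combination (Y 1 z).2 * h1 - (Y 1 z).1 * h2
  have h1 := hdu.self_of_nhds.1
  rw [huk.fderiv_eq] at h1
  simp only [he, fderiv_fun_const, Pi.zero_apply, zero_apply] at h1
  exact Complex.exp_ne_zero _ h1.symm

theorem fderiv_eq_zero_of_wedge {f : ℂ × ℂ →L[ℂ] ℂ} {u v : ℂ × ℂ} (h : wedge u v ≠ 0)
    (hu : f u = 0) (hv : f v = 0) : f = 0 := by
  refine ContinuousLinearMap.ext fun x => ?_
  obtain ⟨s, t, rfl⟩ := exists_coords h x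
  simp [hu, hv]

/-- Two pointwise proportional symmetries of a `3`-web are proportional over `ℂ`. -/
theorem exists_const_of_proportional {w : Fin 3 → ℂ × ℂ → ℂ × ℂ}
    {X Y : ℂ × ℂ → ℂ × ℂ} {q : ℂ × ℂ}
    (hne : ∀ᶠ z in 𝓝 q, ∀ i j, i ≠ j → wedge (w i z) (w j z) ≠ 0)
    (hX : AnalyticAt ℂ X q) (hY : AnalyticAt ℂ Y q)
    (hXw : ∀ᶠ z in 𝓝 q, ∀ i, wedge (w i z) (lieBracket ℂ X (w i) z) = 0)
    (hYw : ∀ᶠ z in 𝓝 q, ∀ i, wedge (w i z) (lieBracket ℂ Y (w i) z) = 0)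
    (h0 : X q ≠ 0) (hp : ∀ᶠ z in 𝓝 q, wedge (X z) (Y z) = 0) :
    ∃ c : ℂ, Y =ᶠ[𝓝 q] fun z => c • X z := by
  obtain ⟨f, hf, hfY⟩ := exists_analytic_quotient hY hX h0 hp
  have hdf : ∀ᶠ z in 𝓝 q, fderiv ℂ f z = 0 := by
    filter_upwards [hne, hXw, hYw, hfY.eventuallyEq_nhds, hX.eventually_analyticAt,
      hX.continuousAt.eventually_ne h0, hf.eventually_analyticAt] with z h1 h2 h3 h4 h5 h6 h7
    -- [fX, w i] = f[X, w i] - (w i f)X, so w i f = 0 unless X is parallel to w i. This exception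
    -- occurs for at most one i, and the other two directions give df = 0.
    have h8 : ∀ i, fderiv ℂ f z (w i z) = 0 ∨ wedge (w i z) (X z) = 0 := by
      intro i
      have h9 := h3 i
      rw [h4.lieBracket_vectorField_eq Filter.EventuallyEq.rfl,
        lieBracket_smul_left h7.differentiableAt h5.differentiableAt, wedge_add_right,
        wedge_smul_right, wedge_smul_right, h2 i] at h9
      simpa using h9
    have h9 : ∀ i j, i ≠ j → wedge (w i z) (X z) = 0 → wedge (w j z) (X z) ≠ 0 := by
      intro i j hij hi hj
      refine h1 i j hij (wedge_eq_zero_of_wedge h6 ?_ ?_)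
      · rw [wedge_swap, hi, neg_zero]
      · rw [wedge_swap, hj, neg_zero]
    by_cases hw0 : wedge (w 0 z) (X z) = 0
    · exact fderiv_eq_zero_of_wedge (h1 1 2 (by decide))
        ((h8 1).resolve_right (h9 0 1 (by decide) hw0))
        ((h8 2).resolve_right (h9 0 2 (by decide) hw0))
    · by_cases hw1 : wedge (w 1 z) (X z) = 0
      · exact fderiv_eq_zero_of_wedge (h1 0 2 (by decide)) ((h8 0).resolve_right hw0)
          ((h8 2).resolve_right (h9 1 2 (by decide) hw1))
      · exact fderiv_eq_zero_of_wedge (h1 0 1 (by decide)) ((h8 0).resolve_right hw0)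
          ((h8 1).resolve_right hw1)
  obtain ⟨ρ, hρ, hball⟩ := Metric.eventually_nhds_iff_ball.1 (hdf.and hf.eventually_analyticAt)
  refine ⟨f q, ?_⟩
  filter_upwards [hfY, Metric.ball_mem_nhds q hρ] with z hz hzb
  have := Metric.isOpen_ball.is_const_of_fderiv_eq_zero (convex_ball q ρ).isPreconnected
    (fun y hy => (hball y hy).2.differentiableAt.differentiableWithinAt)
    (fun y hy => (hball y hy).1) hzb (Metric.mem_ball_self hρ)
  rw [hz, this]

/-- The rank of the local system of symmetries is never two. -/
theorem not_rank_two {F : Polynomial (Holo U)} (hd : 3 ≤ F.natDegree) {B : Set (ℂ × ℂ)}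
    (hB : IsOpen B) {Y : Fin 2 → ℂ × ℂ → ℂ × ℂ} (hY : IsLocalBasis F B Y) {q₀ : ℂ × ℂ}
    (hq₀ : q₀ ∈ regularLocus F) (hq₀B : q₀ ∈ B) : False := by
  obtain ⟨w, ρ, hρ, hw⟩ := exists_ball_frame F (by omega) hq₀
  have : Nontrivial (Fin F.natDegree) := Fin.nontrivial_iff_two_le.2 (by omega)
  set V := Metric.ball q₀ ρ ∩ B with hV
  have hVo : IsOpen V := Metric.isOpen_ball.inter hB
  have hq₀V : q₀ ∈ V := ⟨Metric.mem_ball_self hρ, hq₀B⟩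
  have h0 : ∀ z ∈ V, wedge (Y 0 z) (Y 1 z) = 0 := fun z hz => by
    by_contra h
    exact not_transitive_rank_two hB hY hz.2 (hw z hz.1) h
  have hsym : ∀ i, ∀ z ∈ V, ∀ᶠ z in 𝓝 z, IsSymmetryAt F (Y i) z := fun i z hz =>
    Filter.mem_of_superset (hB.mem_nhds hz.2) (hY.mem i)
  -- Y₀ may vanish at q₀ itself, but not near it identically; the basis property holds at the nearby
  -- point as well.
  obtain ⟨q, hqV, hq⟩ : ∃ q ∈ V, Y 0 q ≠ 0 := by
    by_contra! hcon
    have h1 : Y 0 =ᶠ[𝓝 q₀] 0 := Filter.mem_of_superset (hVo.mem_nhds hq₀V) hcon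
    have h2 := (hY.existsUnique q₀ hq₀B _ (hsym 0 q₀ hq₀V)).unique
      (y₁ := ![1, 0]) (y₂ := ![0, 0])
      (Filter.Eventually.of_forall fun z => by simp [Fin.sum_univ_two])
      (h1.mono fun z hz => by simp [Fin.sum_univ_two, hz])
    simpa using congrFun h2 0
  have hcast : ∀ z ∈ V, ∀ Z, IsSymmetryAt F Z z → ∀ i : Fin 3,
      wedge (w (Fin.castLE hd i) z) (lieBracket ℂ Z (w (Fin.castLE hd i)) z) = 0 :=
    fun z hz Z hZ i => ((isSymmetryAt_iff (hw z hz.1) Z).1 hZ).2 _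
  have hVn := hVo.mem_nhds hqV
  obtain ⟨c, hc⟩ := exists_const_of_proportional (w := fun i => w (Fin.castLE hd i))
    (X := Y 0) (Y := Y 1) (q := q)
    (Filter.mem_of_superset hVn fun z hz i j hij => (hw z hz.1).2.self_of_nhds.2.1 _ _
      fun h => hij (Fin.castLE_injective hd h))
    (hsym 0 q hqV).self_of_nhds.1 (hsym 1 q hqV).self_of_nhds.1
    (Filter.mem_of_superset hVn fun z hz i => hcast z hz _ (hsym 0 z hz).self_of_nhds i)
    (Filter.mem_of_superset hVn fun z hz i => hcast z hz _ (hsym 1 z hz).self_of_nhds i)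
    hq (Filter.mem_of_superset hVn h0)
  have h2 := (hY.existsUnique q hqV.2 _ (hsym 1 q hqV)).unique
    (y₁ := ![0, 1]) (y₂ := ![c, 0])
    (Filter.Eventually.of_forall fun z => by simp [Fin.sum_univ_two])
    (hc.mono fun z hz => by simp [Fin.sum_univ_two, hz])
  simpa using congrFun h2 1

end RankTwo

/-! ### Connectedness of the regular locus and constancy of the rank. -/

noncomputable section Rank

/-- The zeros are isolated, and a discrete Lindelöf space is countable. -/
theorem countable_zeros {h : ℂ → ℂ} {D : Set ℂ} (hD : IsPreconnected D)
    (hh : AnalyticOnNhd ℂ h D) {t : ℂ} (ht : t ∈ D) (h0 : h t ≠ 0) :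
    {z ∈ D | h z = 0}.Countable := by
  set S := {z ∈ D | h z = 0}
  have hdisc : DiscreteTopology S := by
    rw [discreteTopology_subtype_iff]
    intro z hz
    rcases hh.eqOn_zero_or_eventually_ne_zero_of_preconnected hD with h1 | h1
    · exact absurd (h1 ht) h0
    · rcases (hh z hz.1).eventually_eq_zero_or_eventually_ne_zero with h2 | h2
      · exact absurd (hh.eqOn_zero_of_preconnected_of_eventuallyEq_zero hD hz.1 h2 ht) h0
      · rw [← disjoint_iff, Filter.disjoint_principal_right]
        filter_upwards [h2] with y hy hyS using hy hyS.2
  exact (HereditarilyLindelofSpace.isLindelof S).countable hdisc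

/-- Two points of a convex open set of `ℂ` are joined by a polygonal path which avoids the zeros
of a given holomorphic function. -/
theorem exists_preconnected_avoiding_zeros {h : ℂ → ℂ} {D : Set ℂ} (hDo : IsOpen D)
    (hDc : Convex ℝ D) (hh : AnalyticOnNhd ℂ h D) (h0D : (0 : ℂ) ∈ D) (h1D : (1 : ℂ) ∈ D)
    (h0 : h 0 ≠ 0) (h1 : h 1 ≠ 0) :
    ∃ K : Set ℂ, IsPreconnected K ∧ (0 : ℂ) ∈ K ∧ (1 : ℂ) ∈ K ∧ K ⊆ {z ∈ D | h z ≠ 0} := by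
  have hS := countable_zeros hDc.isPreconnected hh h0D h0
  set S := {z ∈ D | h z = 0} with hSdef
  set apex : ℝ → ℂ := fun s => ⟨1 / 2, s⟩ with hapex
  have hcont : Continuous apex := by
    have : apex = fun s : ℝ => (1 / 2 : ℂ) + s * Complex.I := by
      ext s
      apply Complex.ext <;> simp [hapex]
    rw [this]
    fun_prop
  have hmid : apex 0 ∈ D := by
    have : apex 0 = (1 / 2 : ℝ) • (0 : ℂ) + (1 / 2 : ℝ) • (1 : ℂ) := by
      apply Complex.ext <;> simp [hapex]
    rw [this]
    exact hDc h0D h1D (by norm_num) (by norm_num) (by norm_num)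
  obtain ⟨ε, hε, hball⟩ := Metric.mem_nhds_iff.1 ((hDo.preimage hcont).mem_nhds hmid)
  -- The apex of the path is 1/2 + is. A zero on either leg, away from 0 and 1, determines s by one
  -- of these quotients, so only countably many s are excluded.
  have hbad : ((fun z : ℂ => z.im / (2 * z.re)) '' S ∪
      (fun z : ℂ => z.im / (2 * (1 - z.re))) '' S).Countable := (hS.image _).union (hS.image _)
  obtain ⟨s, hsI, hsb⟩ : ∃ s ∈ Set.Ioo (-ε) ε, s ∉ (fun z : ℂ => z.im / (2 * z.re)) '' S ∪
      (fun z : ℂ => z.im / (2 * (1 - z.re))) '' S := by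
    by_contra! hcon
    exact (Cardinal.Real.Ioo_countable_iff (x := -ε) (y := ε)).not.2 (by linarith) (hbad.mono hcon)
  have hsD : apex s ∈ D := hball (by
    rw [Metric.mem_ball, Real.dist_eq, sub_zero, abs_lt]
    exact hsI)
  refine ⟨segment ℝ 0 (apex s) ∪ segment ℝ (apex s) 1, ?_, Or.inl (left_mem_segment _ _ _),
    Or.inr (right_mem_segment _ _ _), ?_⟩
  · exact (convex_segment _ _).isPreconnected.union (apex s) (right_mem_segment _ _ _)
      (left_mem_segment _ _ _) (convex_segment _ _).isPreconnected
  · rintro z (hz | hz)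
    · have hzD : z ∈ D := hDc.segment_subset h0D hsD hz
      refine ⟨hzD, fun hz0 => ?_⟩
      obtain ⟨a, b, ha, hb, hab, rfl⟩ := hz
      by_cases hb0 : b = 0
      · subst hb0
        simp [h0] at hz0
      · refine hsb (Or.inl ⟨_, ⟨hzD, hz0⟩, ?_⟩)
        simp [hapex]
        field_simp
    · have hzD : z ∈ D := hDc.segment_subset hsD h1D hz
      refine ⟨hzD, fun hz0 => ?_⟩
      obtain ⟨a, b, ha, hb, hab, rfl⟩ := hz
      by_cases ha0 : a = 0
      · subst ha0
        rw [zero_add] at hab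
        subst hab
        simp [h1] at hz0
      · refine hsb (Or.inr ⟨_, ⟨hzD, hz0⟩, ?_⟩)
        have hb' : b = 1 - a := by linarith
        subst hb'
        simp [hapex]
        have : 2 * (1 - (a * 2⁻¹ + (1 - a))) = a := by ring
        rw [this]
        field_simp

variable {E : Type*} [NormedAddCommGroup E] [NormedSpace ℂ E]

/-- The complex line through two points meets the ball in a convex set, on which g is a one-variable
function with nonzero values at both points. -/
theorem isPreconnected_ball_diff_zeros {g : E → ℂ} {q : E} {ρ : ℝ}
    (hg : AnalyticOnNhd ℂ g (Metric.ball q ρ)) :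
    IsPreconnected {z ∈ Metric.ball q ρ | g z ≠ 0} := by
  refine isPreconnected_of_forall_pair fun a ha b hb => ?_
  set ℓ : ℂ → E := fun t => a + t • (b - a) with hℓ
  have hℓc : Continuous ℓ := by fun_prop
  have hℓa : AnalyticOnNhd ℂ ℓ Set.univ := fun t _ =>
    analyticAt_const.add (analyticAt_id.smul analyticAt_const)
  have hD : Convex ℝ (ℓ ⁻¹' Metric.ball q ρ) := by
    intro s hs t ht x y hx hy hxy
    have : ℓ (x • s + y • t) = x • ℓ s + y • ℓ t := by
      simp only [hℓ]
      have h1 : a = x • a + y • a := by rw [← add_smul, hxy, one_smul]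
      nth_rewrite 1 [h1]
      simp only [add_smul, smul_add, smul_assoc]
      abel
    change ℓ (x • s + y • t) ∈ Metric.ball q ρ
    rw [this]
    exact convex_ball q ρ hs ht hx hy hxy
  have e0 : ℓ 0 = a := by simp [hℓ]
  have e1 : ℓ 1 = b := by simp [hℓ]
  obtain ⟨K, hK, h0K, h1K, hKD⟩ := exists_preconnected_avoiding_zeros (h := fun t => g (ℓ t))
    (Metric.isOpen_ball.preimage hℓc) hD
    (fun t ht => (hg (ℓ t) ht).comp (hℓa t (Set.mem_univ t)))
    (by rw [Set.mem_preimage, e0]; exact ha.1) (by rw [Set.mem_preimage, e1]; exact hb.1)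
    (by rw [e0]; exact ha.2) (by rw [e1]; exact hb.2)
  refine ⟨ℓ '' K, ?_, ⟨0, h0K, e0⟩, ⟨1, h1K, e1⟩, hK.image _ hℓc.continuousOn⟩
  rintro _ ⟨t, ht, rfl⟩
  exact hKD ht

/-- The complement of an analytic hypersurface in a connected open set is connected. -/
theorem isPreconnected_diff_zeros {g : E → ℂ} {U : Set E} (hUo : IsOpen U)
    (hU : IsPreconnected U) (hg : AnalyticOnNhd ℂ g U) {q₁ : E} (hq₁ : q₁ ∈ U) (h1 : g q₁ ≠ 0) :
    IsPreconnected {z ∈ U | g z ≠ 0} := by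
  have hdense : ∀ q ∈ U, ∀ s ∈ 𝓝 q, ∃ z ∈ s, z ∈ U ∧ g z ≠ 0 := by
    intro q hq s hs
    by_contra! hcon
    refine h1 (hg.eqOn_zero_of_preconnected_of_eventuallyEq_zero hU hq ?_ hq₁)
    filter_upwards [hs, hUo.mem_nhds hq] with z hz hzU using hcon z hz hzU
  intro u v hu hv huv hnu hnv
  by_contra hcon
  have hdisj : ∀ z ∈ U, g z ≠ 0 → z ∈ u → z ∈ v → False := fun z h1 h2 h3 h4 =>
    hcon ⟨z, ⟨h1, h2⟩, h3, h4⟩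
  -- A separation of the complement extends across the zeros: punctured balls are preconnected, so
  -- these open sets cover U, and density of the complement forbids a common point.
  set u' := {q | ∀ᶠ z in 𝓝 q, z ∈ U → g z ≠ 0 → z ∈ u} with hu'
  set v' := {q | ∀ᶠ z in 𝓝 q, z ∈ U → g z ≠ 0 → z ∈ v} with hv'
  have hcov : U ⊆ u' ∪ v' := by
    intro q hq
    obtain ⟨ρ, hρ, hball⟩ := Metric.isOpen_iff.1 hUo q hq
    have hpre := isPreconnected_ball_diff_zeros (hg.mono hball)
    have hsub : {z ∈ Metric.ball q ρ | g z ≠ 0} ⊆ u ∪ v := fun z hz => huv ⟨hball hz.1, hz.2⟩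
    have hmeet : ¬({z ∈ Metric.ball q ρ | g z ≠ 0} ∩ (u ∩ v)).Nonempty := by
      rintro ⟨z, hz, hz1, hz2⟩
      exact hdisj z (hball hz.1) hz.2 hz1 hz2
    by_cases hemp : ({z ∈ Metric.ball q ρ | g z ≠ 0} ∩ v).Nonempty
    · by_cases hemp' : ({z ∈ Metric.ball q ρ | g z ≠ 0} ∩ u).Nonempty
      · exact absurd (hpre u v hu hv hsub hemp' hemp) hmeet
      · right
        filter_upwards [Metric.ball_mem_nhds q hρ] with z hz _ hz0
        exact (hsub ⟨hz, hz0⟩).resolve_left fun h => hemp' ⟨z, ⟨hz, hz0⟩, h⟩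
    · left
      filter_upwards [Metric.ball_mem_nhds q hρ] with z hz _ hz0
      exact (hsub ⟨hz, hz0⟩).resolve_right fun h => hemp ⟨z, ⟨hz, hz0⟩, h⟩
  obtain ⟨q, hqU, hqu, hqv⟩ := hU u' v' isOpen_setOfPred_eventually_nhds
    isOpen_setOfPred_eventually_nhds hcov
    (by
      obtain ⟨z, hz, hzu⟩ := hnu
      exact ⟨z, hz.1, Filter.mem_of_superset (hu.mem_nhds hzu) fun y hy _ _ => hy⟩)
    (by
      obtain ⟨z, hz, hzv⟩ := hnv
      exact ⟨z, hz.1, Filter.mem_of_superset (hv.mem_nhds hzv) fun y hy _ _ => hy⟩)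
  obtain ⟨z, hz, hzU, hz0⟩ := hdense q hqU _ (Filter.inter_mem hqu hqv)
  exact hdisj z hzU hz0 (hz.1 hzU hz0) (hz.2 hzU hz0)

variable {U : Opens (ℂ × ℂ)}

/-- The multiple of the leading coefficient is cancelled pointwise in ℂ, without using that `Holo U`
is a domain. -/
theorem natDegree_derivative_holo {F : Polynomial (Holo U)} (hd : 1 ≤ F.natDegree) :
    F.derivative.natDegree = F.natDegree - 1 := by
  refine le_antisymm (Polynomial.natDegree_derivative_le F)
    (Polynomial.le_natDegree_of_ne_zero ?_)
  rw [Polynomial.coeff_derivative, Nat.sub_add_cancel hd]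
  intro h
  have hF : F.coeff F.natDegree ≠ 0 := fun h0 => by
    have : F.leadingCoeff = 0 := h0
    rw [Polynomial.leadingCoeff_eq_zero] at this
    rw [this, Polynomial.natDegree_zero] at hd
    omega
  refine hF (Subtype.ext (funext fun q => ?_))
  have h1 := congrArg (fun f => evalAt q f) h
  simp only [map_mul, map_add, map_natCast, map_one, map_zero] at h1
  have h2 : (((F.natDegree - 1 : ℕ) : ℂ) + 1) ≠ 0 := Nat.cast_add_one_ne_zero _
  exact (mul_eq_zero.1 h1).resolve_right h2

/-- The regular locus of the web is connected. -/
theorem isPreconnected_regularLocus (hU : IsConnected (U : Set (ℂ × ℂ)))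
    {F : Polynomial (Holo U)} (hd : 1 ≤ F.natDegree) (hF : F.resultant F.derivative ≠ 0) :
    IsPreconnected (regularLocus F : Set (ℂ × ℂ)) := by
  have hdisc : F.discr ≠ 0 := fun h => by
    have := Polynomial.resultant_deriv (f := F) (Polynomial.natDegree_pos_iff_degree_pos.1 hd)
    rw [h, mul_zero, ← natDegree_derivative_holo hd] at this
    exact hF this
  obtain ⟨g, hg, hge⟩ := F.discr.2
  obtain ⟨q₁, hq₁⟩ : ∃ q : U, (F.discr : U → ℂ) q ≠ 0 := by
    by_contra! hcon
    exact hdisc (Subtype.ext (funext hcon))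
  have := isPreconnected_diff_zeros U.isOpen hU.isPreconnected hg q₁.2 (by rw [← hge]; exact hq₁)
  convert! this using 1
  ext z
  constructor
  · rintro ⟨h1, h2⟩
    exact ⟨h1, fun h => h2 ⟨h1, by rw [hge]; exact h⟩⟩
  · rintro ⟨h1, h2⟩
    exact ⟨h1, fun ⟨h3, h4⟩ => h2 (by rw [hge] at h4; exact h4)⟩

/-- Two bases of germs of symmetries near the same point have the same cardinality. -/
theorem IsLocalBasis.le {F : Polynomial (Holo U)} {B B' : Set (ℂ × ℂ)} (hB : IsOpen B) {r r' : ℕ}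
    {Y : Fin r → ℂ × ℂ → ℂ × ℂ} {Y' : Fin r' → ℂ × ℂ → ℂ × ℂ} (hY : IsLocalBasis F B Y)
    (hY' : IsLocalBasis F B' Y') {q : ℂ × ℂ} (hq : q ∈ B) (hq' : q ∈ B') : r ≤ r' := by
  have hsym : ∀ i, ∀ᶠ z in 𝓝 q, IsSymmetryAt F (Y i) z := fun i =>
    Filter.mem_of_superset (hB.mem_nhds hq) (hY.mem i)
  choose C hC _ using fun i => hY'.existsUnique q hq' _ (hsym i)
  -- A relation between the rows of C is a relation between the germs of the Y i, hence trivial.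
  have hinj : Function.Injective (Matrix.vecMulLinear (Matrix.of C) : (Fin r → ℂ) →ₗ[ℂ] _) := by
    rw [← LinearMap.ker_eq_bot, LinearMap.ker_eq_bot']
    intro c hc
    have h0 : ∀ᶠ z in 𝓝 q, IsSymmetryAt F (fun _ => 0) z :=
      Filter.Eventually.of_forall fun z => IsSymmetryAt.zero F z
    refine (hY.existsUnique q hq _ h0).unique ?_ ?_
    · filter_upwards [Filter.eventually_all.2 hC] with z hz
      have : ∀ i, c i • Y i z = ∑ j, (c i * C i j) • Y' j z := fun i => by
        rw [hz i, Finset.smul_sum]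
        simp [smul_smul]
      simp only [this]
      rw [Finset.sum_comm]
      refine (Finset.sum_eq_zero fun j _ => ?_).symm
      rw [← Finset.sum_smul]
      have := congrFun hc j
      simp only [Matrix.vecMulLinear_apply, Matrix.vecMul, dotProduct, Matrix.of_apply,
        Pi.zero_apply] at this
      rw [this, zero_smul]
    · exact Filter.Eventually.of_forall fun z => by simp
  simpa using LinearMap.finrank_le_finrank_of_injective hinj

/-- The rank of the local system of symmetries is constant, and it is `0`, `1` or `3`. -/
theorem exists_rank (hU : IsConnected (U : Set (ℂ × ℂ))) (F : Polynomial (Holo U))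
    (hd : 3 ≤ F.natDegree) (hF : F.resultant F.derivative ≠ 0) :
    ∃ r : ℕ, (r = 0 ∨ r = 1 ∨ r = 3) ∧ ∀ q ∈ regularLocus F, ∃ B : Set (ℂ × ℂ), IsOpen B ∧ q ∈ B ∧
      ∃ Y : Fin r → ℂ × ℂ → ℂ × ℂ, IsLocalBasis F B Y := by
  have hpre := isPreconnected_regularLocus hU (by omega) hF
  rcases (regularLocus F : Set (ℂ × ℂ)).eq_empty_or_nonempty with hemp | ⟨q₁, hq₁⟩
  · refine ⟨0, Or.inl rfl, fun q hq => ?_⟩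
    have : q ∈ (regularLocus F : Set (ℂ × ℂ)) := hq
    rw [hemp] at this
    exact absurd this (Set.notMem_empty q)
  obtain ⟨B₁, hB₁, hqB₁, r, hr3, Y₁, hY₁⟩ := exists_isLocalBasis F hd hq₁
  refine ⟨r, ?_, ?_⟩
  · have : r ≠ 2 := by
      rintro rfl
      exact not_rank_two hd hB₁ hY₁ hq₁ hqB₁
    omega
  set u := {q | ∃ B : Set (ℂ × ℂ), IsOpen B ∧ q ∈ B ∧
      ∃ Y : Fin r → ℂ × ℂ → ℂ × ℂ, IsLocalBasis F B Y} with hu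
  set v := {q | ∃ B : Set (ℂ × ℂ), IsOpen B ∧ q ∈ B ∧ ∃ r' ≠ r,
      ∃ Y : Fin r' → ℂ × ℂ → ℂ × ℂ, IsLocalBasis F B Y} with hv
  have huo : IsOpen u := isOpen_iff_mem_nhds.2 fun q ⟨B, hB, hq, h⟩ =>
    Filter.mem_of_superset (hB.mem_nhds hq) fun z hz => ⟨B, hB, hz, h⟩
  have hvo : IsOpen v := isOpen_iff_mem_nhds.2 fun q ⟨B, hB, hq, h⟩ =>
    Filter.mem_of_superset (hB.mem_nhds hq) fun z hz => ⟨B, hB, hz, h⟩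
  have hdisj : Disjoint u v := by
    rw [Set.disjoint_left]
    rintro q ⟨B, hB, hq, Y, hY⟩ ⟨B', hB', hq', r', hr', Y', hY'⟩
    exact hr' (le_antisymm (hY'.le hB' hY hq' hq) (hY.le hB hY' hq hq'))
  have hcov : (regularLocus F : Set (ℂ × ℂ)) ⊆ u ∪ v := by
    intro q hq
    obtain ⟨B, hB, hqB, r', -, Y, hY⟩ := exists_isLocalBasis F hd hq
    by_cases h : r' = r
    · subst h
      exact Or.inl ⟨B, hB, hqB, Y, hY⟩
    · exact Or.inr ⟨B, hB, hqB, r', h, Y, hY⟩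
  exact hpre.subset_left_of_subset_union huo hvo hdisj hcov
    ⟨q₁, hq₁, B₁, hB₁, hqB₁, Y₁, hY₁⟩

end Rank

/-! ### From local bases to isomorphisms with constant sheaves. -/

noncomputable section LocalSystem

section Sections

variable {Ω : Opens (ℂ × ℂ)} {V : Opens Ω} {W : Opens V}

/-- The point of `ℂ²` underlying a point of an open subset of an open subset of `Ω`. -/
def pt (w : W) : ℂ × ℂ := ((w.1.1 : Ω) : ℂ × ℂ)

theorem isOpenEmbedding_pt : IsOpenEmbedding (pt : W → ℂ × ℂ) :=
  Ω.isOpen.isOpenEmbedding_subtypeVal.comp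
    (V.isOpen.isOpenEmbedding_subtypeVal.comp W.isOpen.isOpenEmbedding_subtypeVal)

theorem eventually_pt {w : W} {P : ℂ × ℂ → Prop} (h : ∀ᶠ w' in 𝓝 w, P (pt w')) :
    ∀ᶠ z in 𝓝 (pt w), P z := by
  rw [← isOpenEmbedding_pt.map_nhds_eq]
  exact h

theorem eventually_of_eventually_pt {w : W} {P : ℂ × ℂ → Prop} (h : ∀ᶠ z in 𝓝 (pt w), P z) :
    ∀ᶠ w' in 𝓝 w, P (pt w') :=
  isOpenEmbedding_pt.continuous.continuousAt.eventually h

/-- `W'` is the open subset `W` of `V`, seen as an open subset of `Ω`. -/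
def IsImage (W : Opens V) (W' : Opens Ω) : Prop := ∀ x : Ω, x ∈ W' ↔ ∃ h : x ∈ V, (⟨x, h⟩ : V) ∈ W

variable {W' : Opens Ω}

/-- The point of `W` corresponding to a point of its image. -/
def IsImage.lift (h : IsImage W W') (x : W') : W :=
  ⟨⟨x.1, ((h x.1).1 x.2).1⟩, ((h x.1).1 x.2).2⟩

/-- The point of the image corresponding to a point of `W`. -/
def IsImage.push (h : IsImage W W') (w : W) : W' :=
  ⟨w.1.1, (h w.1.1).2 ⟨w.1.2, w.2⟩⟩

theorem IsImage.lift_push (h : IsImage W W') (w : W) : h.lift (h.push w) = w := rfl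

theorem IsImage.push_lift (h : IsImage W W') (x : W') : h.push (h.lift x) = x := rfl

theorem IsImage.extend_pt (h : IsImage W W') (s : W' → ℂ × ℂ) (w : W) :
    extend s (pt w) = s (h.push w) := extend_apply s (h.push w)

end Sections

variable {U : Opens (ℂ × ℂ)} {F : Polynomial (Holo U)} {B : Set (ℂ × ℂ)} {r : ℕ}
  {Y : Fin r → ℂ × ℂ → ℂ × ℂ} {V : Opens (regularLocus F)} {W : Opens V}
  {W' : Opens (regularLocus F)}

theorem extend_combination (h : IsImage W W') (f : LocallyConstant W (Fin r → ℂ)) (w : W) :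
    extend (fun x : W' => ∑ i, f (h.lift x) i • Y i ((x : regularLocus F) : ℂ × ℂ))
      =ᶠ[𝓝 (pt w)] fun z => ∑ i, f w i • Y i z := by
  refine eventually_pt ?_
  filter_upwards [f.isLocallyConstant.eventually_eq w] with w' hw'
  have hf : f w' = f w := hw'
  rw [h.extend_pt, h.lift_push, hf]
  rfl

theorem combination_mem_symOn (hY : IsLocalBasis F B Y) (c : Fin r → ℂ) :
    (fun z => ∑ i, c i • Y i z) ∈ symOn F B := by
  have : (fun z => ∑ i, c i • Y i z) = ∑ i, c i • Y i := by
    ext1 z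
    simp [Finset.sum_apply]
  rw [this]
  exact Submodule.sum_mem _ fun i _ => Submodule.smul_mem _ _ (hY.mem i)

/-- Locally constant combinations of a local basis are sections of the sheaf of symmetries. -/
def sectionMap (hY : IsLocalBasis F B Y) (hV : ∀ x ∈ V, (x : ℂ × ℂ) ∈ B) (h : IsImage W W') :
    LocallyConstant W (Fin r → ℂ) →ₗ[ℂ] symmetries F W' where
  toFun f := ⟨fun x => ∑ i, f (h.lift x) i • Y i ((x : regularLocus F) : ℂ × ℂ), fun x =>
    (combination_mem_symOn hY (f (h.lift x)) _ (hV _ (h.lift x).1.2)).congr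
      (extend_combination h f (h.lift x)).symm⟩
  map_add' f g := by
    refine Subtype.ext (funext fun x => ?_)
    simp [add_smul, Finset.sum_add_distrib]
  map_smul' c f := by
    refine Subtype.ext (funext fun x => ?_)
    simp [Finset.smul_sum, smul_smul]

/-- Both halves rest on uniqueness of coefficients of a germ. For surjectivity, the coefficients
found at one point also serve at nearby points, so they are locally constant. -/
theorem sectionMap_bijective (hY : IsLocalBasis F B Y) (hV : ∀ x ∈ V, (x : ℂ × ℂ) ∈ B)
    (h : IsImage W W') : Function.Bijective (sectionMap hY hV h) := by
  have hmem : ∀ w : W, pt w ∈ B := fun w => hV _ w.1.2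
  constructor
  · rw [← LinearMap.ker_eq_bot, LinearMap.ker_eq_bot']
    intro f hf
    ext1 w
    have h0 : ∀ᶠ z in 𝓝 (pt w), IsSymmetryAt F (fun _ => 0) z :=
      Filter.Eventually.of_forall fun z => IsSymmetryAt.zero F z
    refine (hY.existsUnique _ (hmem w) _ h0).unique ?_
      (Filter.Eventually.of_forall fun z => by simp)
    have h1 := extend_combination (Y := Y) h f w
    have h2 : (fun x : W' => ∑ i, f (h.lift x) i • Y i ((x : regularLocus F) : ℂ × ℂ)) =
        fun _ => 0 := congrArg Subtype.val hf
    rw [h2] at h1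
    refine EventuallyEq.trans ?_ h1
    exact eventually_pt (Filter.Eventually.of_forall fun w' => by rw [h.extend_pt])
  · intro s
    have hs : ∀ w : W, ∀ᶠ z in 𝓝 (pt w), IsSymmetryAt F (extend s.1) z := fun w =>
      eventually_pt (Filter.Eventually.of_forall fun w' => s.2 (h.push w'))
    choose c hc hcu using fun w => hY.existsUnique _ (hmem w) _ (hs w)
    have hloc : IsLocallyConstant c := by
      refine IsLocallyConstant.iff_eventually_eq c |>.2 fun w => ?_
      filter_upwards [eventually_of_eventually_pt (hc w).eventuallyEq_nhds] with w' hw'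
      exact (hcu w' _ hw').symm
    refine ⟨⟨c, hloc⟩, Subtype.ext (funext fun x => ?_)⟩
    have h1 := (hc (h.lift x)).eq_of_nhds
    rw [h.extend_pt, h.push_lift] at h1
    exact h1.symm

theorem isImage_functor_obj (V : Opens (TopCat.of (regularLocus F))) (W : Opens (TopCat.of V)) :
    IsImage (Ω := regularLocus F) (V := V) W (V.isOpenEmbedding.functor.obj W) := by
  intro x
  constructor
  · rintro ⟨y, hy, rfl⟩
    exact ⟨y.2, hy⟩
  · rintro ⟨hx, hw⟩
    exact ⟨⟨x, hx⟩, hw, rfl⟩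

/-- On an open set with a basis of symmetries, the sheaf of symmetries is constant. -/
theorem isLocalSystem_of_isLocalBasis (F : Polynomial (Holo U)) (r : ℕ)
    (h : ∀ q ∈ regularLocus F, ∃ B : Set (ℂ × ℂ), IsOpen B ∧ q ∈ B ∧
      ∃ Y : Fin r → ℂ × ℂ → ℂ × ℂ, IsLocalBasis F B Y) :
    IsLocalSystem (symmetrySheaf F) r := by
  intro q
  obtain ⟨B, hB, hqB, Y, hY⟩ := h q.1 q.2
  let V : Opens (TopCat.of (regularLocus F)) :=
    ⟨{x | ((x : regularLocus F) : ℂ × ℂ) ∈ B}, hB.preimage continuous_subtype_val⟩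
  refine ⟨V, hqB, ⟨Iso.symm (NatIso.ofComponents (fun W => LinearEquiv.toModuleIso
    (LinearEquiv.ofBijective
      (sectionMap hY (V := V) (fun x hx => hx) (isImage_functor_obj V W.unop))
      (sectionMap_bijective hY (V := V) (fun x hx => hx) (isImage_functor_obj V W.unop)))) ?_)⟩⟩
  intro W₁ W₂ f
  rfl

end LocalSystem

end PlanarWeb

theorem proposition1 (U : TopologicalSpace.Opens (ℂ × ℂ)) (hU : IsConnected (U : Set (ℂ × ℂ)))
    (F : Polynomial (PlanarWeb.Holo U)) (hd : 3 ≤ F.natDegree)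
    (hF : F.resultant F.derivative ≠ 0) :
    ∃ r : ℕ, (r = 0 ∨ r = 1 ∨ r = 3) ∧
      PlanarWeb.IsLocalSystem (PlanarWeb.symmetrySheaf F) r := by
  obtain ⟨r, hr, h⟩ := PlanarWeb.exists_rank hU F hd hF
  exact ⟨r, hr, PlanarWeb.isLocalSystem_of_isLocalBasis F r h⟩
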